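/- Let $K$ be an algebraically closed field, of arbitrary characteristic. Conventions. For a quiver $Q$ with finite vertex set $Q_0$ and arrow set $Q_1$, write $s(\alpha)$ and $t(\alpha)$ for the start and end of an arrow $\alpha$; paths are composed from right to left, so $\beta\alpha$ is a path if $t(\alpha)=s(\beta)$. $KQ$ is the path algebra and $J$ its ideal generated by the arrows. For a set $I$ of paths of length two, the pair $(Q,I)$ is called gentle if $J^m\subseteq\langle I\rangle\subseteq J^2$ for some $m\ge 2$; each vertex is the start of at most two arrows and the end of at most two arrows; and for each arrow $\alpha$ there is at most one arrow $\beta$ such that $\alpha\beta$ is a path not in $I$, at most one arrow $\gamma$ such that $\gamma\alpha$ is a path not in $I$, at most one arrow $\beta$ such that $\alpha\beta$ is a path in $I$, and at most one arrow $\gamma$ such that $\gamma\alpha$ is a path in $I$. Let $I$ be a set of paths of length two in $Q$ and let $Sp\subseteq Q_0$; vertices in $Sp$ are called special, the others ordinary. Let $Q^{sp}$ be obtained from $Q$ by adding one new loop $\varepsilon_i$ at each $i\in Sp$, and let $I^{sp}=I\cup\{\varepsilon_i^2\mid i\in Sp\}$. The triple $(Q,Sp,I)$ is called skewed-gentle if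 $(Q,I)$ and $(Q^{sp},I^{sp})$ are gentle. The pair $(Q^{sg},I^{sg})$: put $Q_0(i)=\{i\}$ if $i$ is ordinary and $Q_0(i)=\{i^+,i^-\}$ if $i$ is special. The vertex set is $Q^{sg}_0=\bigcup_i Q_0(i)$; the arrows from $a$ to $b$ are the triples $(a,\alpha,b)$ with $\alpha\in Q_1$, $a\in Q_0(s(\alpha))$, $b\in Q_0(t(\alpha))$; and $I^{sg}$ consists of the elements $$\sum_{b\in Q_0(s(\beta))}\lambda_b\,(b,\beta,c)(a,\alpha,b),\qquad \beta\alpha\in I,\ a\in Q_0(s(\alpha)),\ c\in Q_0(t(\beta)),$$ where $\lambda_b=-1$ if $b=i^-$ for some $i$, and $\lambda_b=1$ otherwise. The pair $(Q^{g},I^{g})$: each ordinary vertex $i$ is replaced by two vertices $i^+,i^-$, and each special vertex $i$ is kept; for a special vertex put $i^{\pm}:=i$. The arrows are $\alpha^{\delta}$ for $\alpha\in Q_1$, $\delta\in\{+,-\}$, with $s(\alpha^\delta)=s(\alpha)^\delta$ and $t(\alpha^\delta)=t(\alpha)^\delta$; and $$I^{g}=\{\beta^+\alpha^+,\beta^-\alpha^-\mid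 \beta\alpha\in I,\ t(\alpha)\notin Sp\}\cup\{\beta^+\alpha^-,\beta^-\alpha^+\mid\beta\alpha\in I,\ t(\alpha)\in Sp\}.$$ Theorem. Let $(Q,Sp,I)$ be a skewed-gentle triple. Then the following statements are equivalent: (i) $\operatorname{gl.dim} KQ^{sg}/\langle I^{sg}\rangle<\infty$; (ii) $\operatorname{gl.dim} KQ/\langle I\rangle<\infty$; (iii) $\operatorname{gl.dim} KQ^{g}/\langle I^{g}\rangle<\infty$. -/

import Mathlib

open CategoryTheory

noncomputable section

namespace SkewedGentle

universe u v w

/-! ### Path algebras -/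

/-- All oriented paths of a quiver (of any length, including the trivial path at each vertex),
each recorded together with its starting vertex and its ending vertex. -/
abbrev AnyPath (Q : Type u) [Quiver.{v} Q] : Type (max u v) :=
  Σ a b : Q, Quiver.Path a b

namespace AnyPath

variable {Q : Type u} [Quiver.{v} Q]

/-- The starting vertex of a path. -/
abbrev source (p : AnyPath Q) : Q := p.1

/-- The ending vertex of a path. -/
abbrev target (p : AnyPath Q) : Q := p.2.1

/-- The number of arrows in a path. -/
def length (p : AnyPath Q) : ℕ := p.2.2.length

/-- The path `p q`: first run through `q`, then through `p`. -/
def concat (p q : AnyPath Q) (h : q.target = p.source) : AnyPath Q :=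
  ⟨q.source, p.target, q.2.2.comp (p.2.2.cast h.symm rfl)⟩

end AnyPath

/-- The path algebra `KQ`: the `K`-vector space whose basis is the set of all paths of `Q`. -/
def PathAlgebra (K : Type w) (Q : Type u) [Field K] [Quiver.{v} Q] : Type (max u v w) :=
  AnyPath Q →₀ K

namespace PathAlgebra

section Structure

variable (K : Type w) {Q : Type u} [Field K] [Quiver.{v} Q]

instance : AddCommGroup (PathAlgebra K Q) :=
  inferInstanceAs (AddCommGroup (AnyPath Q →₀ K))

instance : Module K (PathAlgebra K Q) :=
  inferInstanceAs (Module K (AnyPath Q →₀ K))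

/-- The basis element of the path algebra given by a path. -/
def ofPath (p : AnyPath Q) : PathAlgebra K Q := Finsupp.single p (1 : K)

/-- The trivial path `e_a` at the vertex `a`, as an element of the path algebra. -/
def idem (a : Q) : PathAlgebra K Q := ofPath K ⟨a, a, Quiver.Path.nil⟩

/-- An arrow, as an element of the path algebra. -/
def ofArrow {a b : Q} (α : a ⟶ b) : PathAlgebra K Q := ofPath K ⟨a, b, α.toPath⟩

open Classical in
/-- The product of two paths: `p q` (first `q`, then `p`) if `q` ends where `p` starts,
and `0` otherwise. -/
def mulPath (p q : AnyPath Q) : PathAlgebra K Q :=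
  if h : q.target = p.source then ofPath K (p.concat q h) else 0

/-- The `K`-bilinear extension of the product of paths. -/
def mulHom : PathAlgebra K Q →ₗ[K] PathAlgebra K Q →ₗ[K] PathAlgebra K Q :=
  Finsupp.linearCombination K fun p =>
    (Finsupp.linearCombination K (mulPath K p) : (AnyPath Q →₀ K) →ₗ[K] PathAlgebra K Q)

instance : Mul (PathAlgebra K Q) := ⟨fun x y => mulHom K x y⟩

instance [Finite Q] : One (PathAlgebra K Q) :=
  ⟨letI := Fintype.ofFinite Q; ∑ a : Q, idem K a⟩

variable {K}

theorem mul_def (x y : PathAlgebra K Q) : x * y = mulHom K x y := rfl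

theorem one_def [Finite Q] :
    (1 : PathAlgebra K Q) = letI := Fintype.ofFinite Q; ∑ a : Q, idem K a := rfl

theorem mulHom_ofPath (p q : AnyPath Q) :
    mulHom K (ofPath K p) (ofPath K q) = mulPath K p q := by
  have h1 : mulHom K (ofPath K p) = Finsupp.linearCombination K (mulPath K p) := by
    simp only [mulHom, ofPath]
    erw [Finsupp.linearCombination_single, one_smul]
  rw [h1]
  simp only [ofPath]
  erw [Finsupp.linearCombination_single, one_smul]

theorem hom_ext {M : Type*} [AddCommGroup M] [Module K M] {f g : PathAlgebra K Q →ₗ[K] M}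
    (h : ∀ p, f (ofPath K p) = g (ofPath K p)) : f = g :=
  Finsupp.lhom_ext' fun p => LinearMap.ext_ring (h p)

theorem ofPath_mul_ofPath_mul_ofPath (p q r : AnyPath Q) :
    mulHom K (mulHom K (ofPath K p) (ofPath K q)) (ofPath K r) =
      mulHom K (ofPath K p) (mulHom K (ofPath K q) (ofPath K r)) := by
  obtain ⟨p₁, p₂, p⟩ := p
  obtain ⟨q₁, q₂, q⟩ := q
  obtain ⟨r₁, r₂, r⟩ := r
  rw [mulHom_ofPath, mulHom_ofPath]
  unfold mulPath
  by_cases h1 : q₂ = p₁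
  · subst h1
    by_cases h2 : r₂ = q₁
    · subst h2
      simp [mulHom_ofPath, mulPath, AnyPath.concat, Quiver.Path.comp_assoc]
    · simp [mulHom_ofPath, mulPath, AnyPath.concat, h2]
  · by_cases h2 : r₂ = q₁
    · subst h2
      simp [mulHom_ofPath, mulPath, AnyPath.concat, h1]
    · simp [h1, h2]

protected theorem mul_assoc (x y z : PathAlgebra K Q) : x * y * z = x * (y * z) := by
  have h1 : ∀ p q : AnyPath Q, (mulHom K) (mulHom K (ofPath K p) (ofPath K q)) =
      (mulHom K (ofPath K p)).comp (mulHom K (ofPath K q)) := fun p q =>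
    hom_ext fun r => ofPath_mul_ofPath_mul_ofPath p q r
  have h2 : ∀ p : AnyPath Q, ((mulHom K).flip z).comp (mulHom K (ofPath K p)) =
      (mulHom K (ofPath K p)).comp ((mulHom K).flip z) := fun p =>
    hom_ext fun q => LinearMap.congr_fun (h1 p q) z
  have h3 : ((mulHom K).flip z).comp ((mulHom K).flip y) =
      (mulHom K).flip (mulHom K y z) :=
    hom_ext fun p => LinearMap.congr_fun (h2 p) y
  exact LinearMap.congr_fun h3 x

theorem idem_mul_ofPath (a : Q) (p : AnyPath Q) [Decidable (p.target = a)] :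
    mulHom K (idem K a) (ofPath K p) = if p.target = a then ofPath K p else 0 := by
  obtain ⟨p₁, p₂, p⟩ := p
  rw [idem, mulHom_ofPath]
  unfold mulPath
  by_cases h : p₂ = a
  · subst h
    simp [AnyPath.concat]
  · simp [h]

theorem ofPath_mul_idem (a : Q) (p : AnyPath Q) [Decidable (p.source = a)] :
    mulHom K (ofPath K p) (idem K a) = if p.source = a then ofPath K p else 0 := by
  obtain ⟨p₁, p₂, p⟩ := p
  rw [idem, mulHom_ofPath]
  unfold mulPath
  by_cases h : p₁ = a
  · subst h
    simp [AnyPath.concat]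
  · simp [h, Ne.symm h]

protected theorem one_mul [Finite Q] (x : PathAlgebra K Q) : 1 * x = x := by
  classical
  have h : mulHom K (1 : PathAlgebra K Q) = LinearMap.id := hom_ext fun p => by
    rw [one_def, map_sum, LinearMap.sum_apply]
    simp [idem_mul_ofPath]
  exact LinearMap.congr_fun h x

protected theorem mul_one [Finite Q] (x : PathAlgebra K Q) : x * 1 = x := by
  classical
  have h : (mulHom K).flip (1 : PathAlgebra K Q) = LinearMap.id := hom_ext fun p => by
    rw [LinearMap.flip_apply, one_def, map_sum]
    simp [ofPath_mul_idem]
  exact LinearMap.congr_fun h x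

end Structure

variable {K : Type w} {Q : Type u} [Field K] [Quiver.{v} Q]

instance [Finite Q] : Ring (PathAlgebra K Q) :=
  { (inferInstance : AddCommGroup (PathAlgebra K Q)),
    (inferInstance : Mul (PathAlgebra K Q)),
    (inferInstance : One (PathAlgebra K Q)) with
    mul_assoc := PathAlgebra.mul_assoc
    one_mul := PathAlgebra.one_mul
    mul_one := PathAlgebra.mul_one
    left_distrib := fun x y z => by simp only [mul_def, map_add]
    right_distrib := fun x y z => by simp only [mul_def, map_add, LinearMap.add_apply]
    zero_mul := fun x => by simp only [mul_def, map_zero, LinearMap.zero_apply]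
    mul_zero := fun x => by simp only [mul_def, map_zero] }

instance [Finite Q] : Algebra K (PathAlgebra K Q) :=
  Algebra.ofModule
    (fun c x y => by simp only [mul_def, map_smul, LinearMap.smul_apply])
    (fun c x y => by simp only [mul_def, map_smul])

variable (K Q) in
/-- The power `J ^ l` of the arrow ideal `J` of the path algebra:
the subspace spanned by all paths of length at least `l`. -/
def arrowIdealPow (l : ℕ) : Submodule K (PathAlgebra K Q) :=
  Submodule.span K (ofPath K '' {p : AnyPath Q | l ≤ p.length})

/-- A two-sided ideal `A` of the path algebra is admissible if `J ^ m ⊆ A ⊆ J ^ 2` for some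
`m ≥ 2`, where `J` is the arrow ideal. -/
def IsAdmissible [Finite Q] (A : TwoSidedIdeal (PathAlgebra K Q)) : Prop :=
  (∃ m : ℕ, 2 ≤ m ∧ (arrowIdealPow K Q m : Set (PathAlgebra K Q)) ⊆ A) ∧
    (A : Set (PathAlgebra K Q)) ⊆ arrowIdealPow K Q 2

end PathAlgebra

/-- The factor algebra `KQ / ⟨R⟩` of the path algebra by the two-sided ideal generated by a set
`R` of relations. -/
abbrev BoundQuiverAlgebra (K : Type w) {Q : Type u} [Field K] [Quiver.{v} Q] [Finite Q]
    (R : Set (PathAlgebra K Q)) : Type (max u v w) :=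
  (TwoSidedIdeal.span R).ringCon.Quotient

/-- The (left) global dimension of a ring: the supremum of the projective dimensions of all
its left modules. -/
def globalDimension (A : Type u) [Ring A] : WithBot ℕ∞ :=
  ⨆ M : ModuleCat.{u} A, projectiveDimension M

/-! ### Gentle pairs -/

/-- A set `I` of paths of length two of `Q`: for composable arrows `α : a ⟶ b` and `β : b ⟶ c`,
the proposition `I α β` says that the path `βα` (first `α`, then `β`) belongs to `I`. -/
abbrev QuadraticRelations (Q : Type u) [Quiver.{v} Q] : Type (max u v) :=
  ∀ ⦃a b c : Q⦄, (a ⟶ b) → (b ⟶ c) → Prop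

/-- A set of paths of length two, as a set of elements of the path algebra. -/
inductive zeroRelations (K : Type w) {Q : Type u} [Field K] [Quiver.{v} Q]
    (I : QuadraticRelations Q) : Set (PathAlgebra K Q)
  | intro {a b c : Q} (α : a ⟶ b) (β : b ⟶ c) (h : I α β) :
      zeroRelations K I (PathAlgebra.ofArrow K β * PathAlgebra.ofArrow K α)

/-- The pair `(Q, I)`, where `I` is a set of paths of length two, is gentle. -/
structure IsGentle (K : Type w) {Q : Type u} [Field K] [Quiver.{v} Q] [Finite Q]
    (I : QuadraticRelations Q) : Prop where
  /-- The ideal generated by `I` in `KQ` is admissible. -/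
  admissible : PathAlgebra.IsAdmissible (TwoSidedIdeal.span (zeroRelations K I))
  /-- Each vertex is the starting point of at most two arrows. -/
  card_out_le (a : Q) : ENat.card (Σ b : Q, a ⟶ b) ≤ 2
  /-- Each vertex is the end point of at most two arrows. -/
  card_in_le (b : Q) : ENat.card (Σ a : Q, a ⟶ b) ≤ 2
  /-- For each arrow `α` there is at most one arrow `β` such that `αβ` is a path not in `I`. -/
  before_notMem {b c : Q} (α : b ⟶ c) : {β : Σ a : Q, a ⟶ b | ¬ I β.2 α}.Subsingleton
  /-- For each arrow `α` there is at most one arrow `γ` such that `γα` is a path not in `I`. -/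
  after_notMem {a b : Q} (α : a ⟶ b) : {γ : Σ c : Q, b ⟶ c | ¬ I α γ.2}.Subsingleton
  /-- For each arrow `α` there is at most one arrow `β` such that `αβ` is a path in `I`. -/
  before_mem {b c : Q} (α : b ⟶ c) : {β : Σ a : Q, a ⟶ b | I β.2 α}.Subsingleton
  /-- For each arrow `α` there is at most one arrow `γ` such that `γα` is a path in `I`. -/
  after_mem {a b : Q} (α : a ⟶ b) : {γ : Σ c : Q, b ⟶ c | I α γ.2}.Subsingleton

/-! ### Skewed-gentle triples -/

section SpecialLoops

variable {Q : Type u} [Quiver.{v} Q]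

/-- The vertices of the quiver `Q^sp`: one vertex for each vertex of `Q`. -/
@[ext]
structure Qsp (Sp : Set Q) : Type u where
  base : Q

instance (Sp : Set Q) [Finite Q] : Finite (Qsp Sp) :=
  Finite.of_injective Qsp.base fun _ _ h => Qsp.ext h

/-- The arrows of `Q^sp`: those of `Q`, and one new loop at each special vertex. -/
inductive SpArrow (Sp : Set Q) : Qsp Sp → Qsp Sp → Type (max u v)
  | old {a b : Q} (α : a ⟶ b) : SpArrow Sp ⟨a⟩ ⟨b⟩
  | loop (i : Q) (hi : i ∈ Sp) : SpArrow Sp ⟨i⟩ ⟨i⟩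

instance (Sp : Set Q) : Quiver.{max u v} (Qsp Sp) := ⟨SpArrow Sp⟩

/-- The set `I^sp`: the paths in `I`, and the squares of the new loops. -/
inductive SpRelations (I : QuadraticRelations Q) (Sp : Set Q) : QuadraticRelations (Qsp Sp)
  | old {a b c : Q} (α : a ⟶ b) (β : b ⟶ c) (h : I α β) :
      SpRelations I Sp (SpArrow.old α) (SpArrow.old β)
  | loop_sq (i : Q) (hi : i ∈ Sp) :
      SpRelations I Sp (SpArrow.loop i hi) (SpArrow.loop i hi)

/-- `(Q, Sp, I)` is a skewed-gentle triple: `(Q, I)` and `(Q^sp, I^sp)` are gentle pairs. -/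
structure IsSkewedGentle (K : Type w) [Field K] [Finite Q] (I : QuadraticRelations Q)
    (Sp : Set Q) : Prop where
  gentle : IsGentle K I
  gentle_sp : IsGentle K (SpRelations I Sp)

end SpecialLoops

/-! ### Splitting vertices -/

/-- The vertices of `Q` where each vertex `i ∈ S` has been replaced by two vertices
`i⁺` (sign `true`) and `i⁻` (sign `false`). -/
inductive SplitVertex {Q : Type u} (S : Set Q) : Type u
  | single (i : Q) (hi : i ∉ S) : SplitVertex S
  | double (i : Q) (hi : i ∈ S) (δ : Bool) : SplitVertex S

namespace SplitVertex

variable {Q : Type u} {S : Set Q}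

/-- The vertex of `Q` from which a vertex comes. -/
def base : SplitVertex S → Q
  | single i _ => i
  | double i _ _ => i

open Classical in
/-- For a vertex `i` of `Q` and a sign `δ`: the vertex `i^δ` if `i ∈ S`, and `i` otherwise. -/
def withSign (S : Set Q) (i : Q) (δ : Bool) : SplitVertex S :=
  if hi : i ∈ S then double i hi δ else single i hi

instance [Finite Q] : Finite (SplitVertex S) :=
  Finite.of_surjective (fun x : Q × Bool => withSign S x.1 x.2) (by
    rintro (⟨i, hi⟩ | ⟨i, hi, δ⟩)
    · exact ⟨(i, true), by simp [withSign, hi]⟩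
    · exact ⟨(i, δ), by simp [withSign, hi]⟩)

end SplitVertex

/-! ### The skewed-gentle pair `(Q^sg, I^sg)` -/

section SkewedGentlePair

variable {Q : Type u} [Quiver.{v} Q]

/-- The vertices of `Q^sg`: the special vertices of `Q` are doubled. -/
def Qsg (Sp : Set Q) : Type u := SplitVertex Sp

instance (Sp : Set Q) [Finite Q] : Finite (Qsg Sp) :=
  inferInstanceAs (Finite (SplitVertex Sp))

/-- The vertex of `Q` from which a vertex of `Q^sg` comes. -/
def Qsg.base {Sp : Set Q} (a : Qsg Sp) : Q := SplitVertex.base a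

/-- The vertex `j` of `Q^sg`, for an ordinary vertex `j`. -/
def Qsg.ordinary {Sp : Set Q} (j : Q) (hj : j ∉ Sp) : Qsg Sp := SplitVertex.single j hj

/-- The vertex `j⁺` of `Q^sg`, for a special vertex `j`. -/
def Qsg.plus {Sp : Set Q} (j : Q) (hj : j ∈ Sp) : Qsg Sp := SplitVertex.double j hj true

/-- The vertex `j⁻` of `Q^sg`, for a special vertex `j`. -/
def Qsg.minus {Sp : Set Q} (j : Q) (hj : j ∈ Sp) : Qsg Sp := SplitVertex.double j hj false

/-- The arrows of `Q^sg` from `a` to `b` are the triples `(a, α, b)`, where `α` is an arrow of `Q`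
from the vertex under `a` to the vertex under `b`. -/
structure SgArrow (Sp : Set Q) (a b : Qsg Sp) : Type v where
  arrow : a.base ⟶ b.base

instance (Sp : Set Q) : Quiver.{v} (Qsg Sp) := ⟨SgArrow Sp⟩

/-- The arrow `(a, α, b)` of `Q^sg`, as an element of the path algebra. -/
def sgArrow (K : Type w) [Field K] {Sp : Set Q} (a b : Qsg Sp) (α : a.base ⟶ b.base) :
    PathAlgebra K (Qsg Sp) :=
  PathAlgebra.ofArrow K (show a ⟶ b from ⟨α⟩)

/-- The set `I^sg`. For each path `βα` in `I` with middle vertex `j`, each vertex `a` over the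
starting vertex of `α` and each vertex `c` over the ending vertex of `β`, it contains the signed
sum of `(b, β, c)(a, α, b)` over all vertices `b` over `j`, with sign `-1` for `b = j⁻` and
`1` otherwise. -/
inductive sgRelations (K : Type w) [Field K] (I : QuadraticRelations Q) (Sp : Set Q) :
    Set (PathAlgebra K (Qsg Sp))
  | ordinary (a c : Qsg Sp) (j : Q) (hj : j ∉ Sp) (α : a.base ⟶ j) (β : j ⟶ c.base)
      (h : I α β) :
      sgRelations K I Sp
        (sgArrow K (Qsg.ordinary j hj) c β * sgArrow K a (Qsg.ordinary j hj) α)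
  | special (a c : Qsg Sp) (j : Q) (hj : j ∈ Sp) (α : a.base ⟶ j) (β : j ⟶ c.base)
      (h : I α β) :
      sgRelations K I Sp
        (sgArrow K (Qsg.plus j hj) c β * sgArrow K a (Qsg.plus j hj) α
          - sgArrow K (Qsg.minus j hj) c β * sgArrow K a (Qsg.minus j hj) α)

end SkewedGentlePair

/-! ### The associated gentle pair `(Q^g, I^g)` -/

section AssociatedGentlePair

variable {Q : Type u} [Quiver.{v} Q]

/-- The vertices of `Q^g`: the ordinary vertices of `Q` are doubled. -/
def Qg (Sp : Set Q) : Type u := SplitVertex Spᶜ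

instance (Sp : Set Q) [Finite Q] : Finite (Qg Sp) :=
  inferInstanceAs (Finite (SplitVertex Spᶜ))

/-- The vertex of `Q` from which a vertex of `Q^g` comes. -/
def Qg.base {Sp : Set Q} (a : Qg Sp) : Q := SplitVertex.base a

/-- The vertex `i^δ` of `Q^g` if `i` is ordinary, and the vertex `i` if `i` is special. -/
def Qg.withSign (Sp : Set Q) (i : Q) (δ : Bool) : Qg Sp := SplitVertex.withSign Spᶜ i δ

/-- The arrows of `Q^g`: each arrow `α : i ⟶ j` of `Q` gives the two arrows `α^δ`, `δ = ±`,
where `α^δ` starts at `i^δ` (at `i` if `i` is special) and ends at `j^δ` (at `j` if `j` is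
special). -/
structure GArrow (Sp : Set Q) (a b : Qg Sp) : Type v where
  /-- The underlying arrow `α` of `Q`. -/
  arrow : a.base ⟶ b.base
  /-- The sign `δ`. -/
  sign : Bool
  source_eq : Qg.withSign Sp a.base sign = a
  target_eq : Qg.withSign Sp b.base sign = b

instance (Sp : Set Q) : Quiver.{v} (Qg Sp) := ⟨GArrow Sp⟩

/-- The set `I^g`: for each path `βα` in `I`, it contains the paths `β^δ α^δ` if the vertex
between `α` and `β` is ordinary, and the paths `β^δ α^ε` with `δ ≠ ε` if it is special. -/
def GRelations (I : QuadraticRelations Q) (Sp : Set Q) : QuadraticRelations (Qg Sp) :=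
  fun _ b _ (α : GArrow Sp _ b) (β : GArrow Sp b _) =>
    I α.arrow β.arrow ∧
      ((b.base ∉ Sp ∧ β.sign = α.sign) ∨ (b.base ∈ Sp ∧ β.sign ≠ α.sign))

end AssociatedGentlePair

end SkewedGentle

end

/-! All three conditions are equivalent to one combinatorial condition, `RelationsTerminate I`:
there is no infinite sequence of arrows of `Q` in which every two consecutive arrows compose to an
element of `I`.

Each of the three algebras is presented by idempotents `e_a` and arrows `(a, α, b)`, where `α` runs
through classes of arrows and `a`, `b` lie over its ends. After a rescaling that absorbs signs, the
relations are `∑_b (b, β, c)(a, α, b) = 0` for certain pairs `α, β`. Let `Ω α` (`relSpan`) be the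
left module generated by the rows `((b, β, c))_b` over all `β` related to `α`. If these relations
give all left linear relations between arrows starting at one vertex, there are exact sequences `0 →
⊕ Ω β → ⊕ P β → Ω α → 0`, with `β` running over the classes related to `α` and with `P β`
projective. The radical of `A e_a` has the same kind of presentation, with `β` running over the
classes that start under `a`. If related sequences terminate, every `Ω α` has finite projective
dimension; so do the radicals and, since long products of arrows vanish, all modules with a common
bound. Conversely, each step along a relation lowers the projective dimension of `Ω`. Once `Ω α` is
projective, the sequence splits, and Nakayama's lemma forces `Ω β = 0`, so nothing is related to
`β`. This is `SplitAlgebra.globalDimension_lt_top_iff`.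

Two inputs remain. The absence of further linear relations is seen on an explicit representation
(`QuiverCover.mem_relSpan_of_sum_eq_zero`). Nilpotency comes from the admissibility of `I^sp`: a
nonzero product of arrows can pass through a relation only at a special vertex, and inserting the
special loop there gives a path of `Q^sp` avoiding `I^sp` (`exists_length_lt_of_isChain`). Finally,
sequences of relations in `Q^g` project to `Q` and lift back (`relationsTerminate_gRelations_iff`).
-/

noncomputable section

namespace SkewedGentle

universe u v w

/-! ### Projective dimension of modules -/

section ProjectiveDimension

variable {A : Type u} [Ring A]

/-- The module `M` has projective dimension at most `n`. -/
def PdLE (A : Type u) [Ring A] (M : Type u) [AddCommGroup M] [Module A M] (n : ℕ) : Prop :=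
  HasProjectiveDimensionLE (ModuleCat.of A M) n

variable {M N P : Type u} [AddCommGroup M] [Module A M] [AddCommGroup N] [Module A N]
  [AddCommGroup P] [Module A P]

theorem pdLE_zero_iff : PdLE A M 0 ↔ Module.Projective A M := by
  rw [PdLE, ← projective_iff_hasProjectiveDimensionLE_zero, ← IsProjective.iff_projective]

theorem PdLE.mono {m n : ℕ} (h : PdLE A M m) (hmn : m ≤ n) : PdLE A M n := by
  have : HasProjectiveDimensionLT (ModuleCat.of A M) (m + 1) := h
  exact hasProjectiveDimensionLT_of_ge _ (m + 1) _ (by lia)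

theorem PdLE.of_projective (n : ℕ) [h : Module.Projective A M] : PdLE A M n :=
  (pdLE_zero_iff.2 h).mono (Nat.zero_le _)

theorem PdLE.of_retract {n : ℕ} (h : PdLE A N n) (i : M →ₗ[A] N) (r : N →ₗ[A] M)
    (hri : ∀ x, r (i x) = x) : PdLE A M n := by
  have : HasProjectiveDimensionLT (ModuleCat.of A N) (n + 1) := h
  exact Retract.hasProjectiveDimensionLT (X := ModuleCat.of A M) (Y := ModuleCat.of A N)
    ⟨ModuleCat.ofHom i, ModuleCat.ofHom r, by ext x; exact hri x⟩ (n + 1)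

section Exact

variable {f : M →ₗ[A] N} {g : N →ₗ[A] P}

theorem shortExact_of_exact (hf : Function.Injective f) (hg : Function.Surjective g)
    (hfg : Function.Exact f g) :
    (ShortComplex.mk (ModuleCat.ofHom f) (ModuleCat.ofHom g)
      (by ext x; exact (hfg _).2 ⟨x, rfl⟩)).ShortExact :=
  have : Mono (ModuleCat.ofHom f) := (ModuleCat.mono_iff_injective _).2 hf
  have : Epi (ModuleCat.ofHom g) := (ModuleCat.epi_iff_surjective _).2 hg
  { exact := (ShortComplex.ShortExact.moduleCat_exact_iff_function_exact _).2 hfg }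

theorem PdLE.middle (hf : Function.Injective f) (hg : Function.Surjective g)
    (hfg : Function.Exact f g) {n : ℕ} (h₁ : PdLE A M n) (h₃ : PdLE A P n) : PdLE A N n :=
  (shortExact_of_exact hf hg hfg).hasProjectiveDimensionLT_X₂ _ h₁ h₃

theorem PdLE.right (hf : Function.Injective f) (hg : Function.Surjective g)
    (hfg : Function.Exact f g) {n : ℕ} (h₁ : PdLE A M n) (h₂ : PdLE A N (n + 1)) :
    PdLE A P (n + 1) :=
  (shortExact_of_exact hf hg hfg).hasProjectiveDimensionLT_X₃ _ h₁ h₂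

theorem PdLE.left (hf : Function.Injective f) (hg : Function.Surjective g)
    (hfg : Function.Exact f g) {n : ℕ} (h₂ : PdLE A N n) (h₃ : PdLE A P (n + 1)) :
    PdLE A M n :=
  (shortExact_of_exact hf hg hfg).hasProjectiveDimensionLT_X₁ _ h₂ h₃

end Exact

open DirectSum in
theorem mem_range_lmap {R : Type*} [Ring R] {ι : Type*} {M N : ι → Type*}
    [∀ i, AddCommGroup (M i)] [∀ i, Module R (M i)] [∀ i, AddCommGroup (N i)]
    [∀ i, Module R (N i)] (f : ∀ i, M i →ₗ[R] N i) {x : ⨁ i, N i}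
    (hx : ∀ i, ∃ y, f i y = x i) : ∃ y, DirectSum.lmap f y = x := by
  classical
  choose y hy using hx
  -- Off the support of `x` the preimage is 0, which keeps the family finitely supported.
  refine ⟨DFinsupp.mk x.support fun i => y i, ?_⟩
  ext i : 1
  rw [DirectSum.lmap_apply]
  by_cases hi : i ∈ x.support
  · erw [DFinsupp.mk_of_mem hi]
    exact hy i
  · erw [DFinsupp.mk_of_notMem hi, map_zero]
    exact (DFinsupp.notMem_support_iff.1 hi).symm

open DirectSum in
-- Dimension shifting along a free cover of each summand; a direct sum of exact sequences is exact.
-- The index set may be infinite.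
theorem PdLE.directSum {A : Type (max v u)} [Ring A] {ι : Type v} {n : ℕ}
    {M : ι → Type (max v u)} [∀ i, AddCommGroup (M i)]
    [∀ i, Module A (M i)] (h : ∀ i, PdLE A (M i) n) : PdLE A (⨁ i, M i) n := by
  classical
  induction n generalizing M with
  | zero =>
    have := fun i => pdLE_zero_iff.1 (h i)
    exact pdLE_zero_iff.2 inferInstance
  | succ n ih =>
    let g : ∀ i, (M i →₀ A) →ₗ[A] M i := fun i => Finsupp.linearCombination A id
    have hg : ∀ i, Function.Surjective (g i) := fun i =>
      Finsupp.linearCombination_id_surjective A (M i)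
    have hk : ∀ i, PdLE A (LinearMap.ker (g i)) n := fun i =>
      PdLE.left (Submodule.injective_subtype _) (hg i)
        (LinearMap.exact_subtype_ker_map (g i)) (PdLE.of_projective n) (h i)
    refine PdLE.right (N := ⨁ i, (M i →₀ A))
      (f := DirectSum.lmap fun i => (LinearMap.ker (g i)).subtype)
      (g := DirectSum.lmap g) ?_ ?_ ?_ (ih hk) (PdLE.of_projective _)
    · exact (DirectSum.lmap_injective _).2 fun i => Submodule.injective_subtype _
    · exact (DirectSum.lmap_surjective _).2 hg
    · intro x
      constructor
      · intro hx
        refine mem_range_lmap _ fun i => ⟨⟨x i, ?_⟩, rfl⟩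
        rw [LinearMap.mem_ker, ← DirectSum.lmap_apply, hx]
        rfl
      · rintro ⟨y, rfl⟩
        ext i : 1
        rw [DirectSum.lmap_apply, DirectSum.lmap_apply]
        exact (y i).2

/-- A supremum in `WithBot ℕ∞` below `⊤` is `⊥` or a natural number, which then bounds all
projective dimensions uniformly. -/
theorem globalDimension_lt_top_iff :
    globalDimension A < ⊤ ↔ ∃ d : ℕ, ∀ (M : Type u) [AddCommGroup M] [Module A M], PdLE A M d := by
  constructor
  · intro h
    have : ∃ d : ℕ, globalDimension A ≤ d := by
      generalize globalDimension A = x at h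
      induction x with
      | bot => exact ⟨0, bot_le⟩
      | coe x =>
        induction x with
        | top => exact absurd h (lt_irrefl _)
        | coe x => exact ⟨x, le_rfl⟩
    obtain ⟨d, hd⟩ := this
    exact ⟨d, fun M _ _ => (projectiveDimension_le_iff _ _).1 ((le_iSup _ (ModuleCat.of A M)).trans hd)⟩
  · rintro ⟨d, hd⟩
    refine lt_of_le_of_lt (b := (d : WithBot ℕ∞)) (iSup_le fun M => ?_) ?_
    · exact (projectiveDimension_le_iff _ _).2 (hd M)
    · exact WithBot.coe_lt_coe.2 (ENat.natCast_lt_top d)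

end ProjectiveDimension

/-! ### Split quadratic algebras -/

/-- A `K`-algebra generated by idempotents `e a` and elements `arr a α b`, where `α` runs through
arrows of a base quiver and `a`, `b` through the vertices over its ends, subject to relations
`∑ b, arr b β c * arr a α b = 0` for the pairs with `rel α β`. -/
structure SplitAlgebra (K : Type w) (A : Type (max u v w)) [Field K] [Ring A] [Algebra K A]
    (V : Type u) (C : Type (max u v)) [Fintype V] [Fintype C] where
  e : V → A
  arr : V → C → V → A
  /-- `Src α a` says that `a` lies over the start of `α`. -/
  Src : C → V → Prop
  /-- `Tgt α b` says that `b` lies over the end of `α`. -/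
  Tgt : C → V → Prop
  rel : C → C → Prop
  exists_src (α : C) : ∃ a, Src α a
  exists_tgt (α : C) : ∃ a, Tgt α a
  src_iff_tgt {α β : C} (h : rel α β) (b : V) : Src β b ↔ Tgt α b
  e_mul_self (a : V) : e a * e a = e a
  e_mul_of_ne {a b : V} (h : a ≠ b) : e a * e b = 0
  sum_e : ∑ a, e a = 1
  e_mul_arr (a α b) : e b * arr a α b = arr a α b
  arr_mul_e (a α b) : arr a α b * e a = arr a α b
  arr_ne_zero_iff (a α b) : arr a α b ≠ 0 ↔ Src α a ∧ Tgt α b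
  sum_arr_mul_arr {α β : C} (h : rel α β) (a c : V) : ∑ b, arr b β c * arr a α b = 0
  exists_eq_sum (x : A) : ∃ (k : V → K) (y : V → C → V → A),
    x = ∑ a, k a • e a + ∑ a, ∑ α, ∑ b, y a α b * arr a α b
  exists_prod_eq_zero : ∃ n : ℕ, ∀ l : List (V × C × V), l.length = n →
    (l.map fun p => arr p.1 p.2.1 p.2.2).prod = 0
  -- The axiom that makes syzygies computable: left linear relations between arrows starting at `a`
  -- split by classes, and within one class they follow from the defining relations.
  mem_span_of_sum_eq_zero (a : V) (x : C → V → A)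
    (hx : ∀ α b, x α b * e b = x α b) (hx' : ∀ α b, ¬ Tgt α b → x α b = 0)
    (h : ∑ α, ∑ b, x α b * arr a α b = 0) (α : C) (hα : Src α a) :
    x α ∈ Submodule.span A {y : V → A | ∃ β c, rel α β ∧ y = fun b => arr b β c}

namespace SplitAlgebra

variable {K : Type w} {A : Type (max u v w)} [Field K] [Ring A] [Algebra K A]
  {V : Type u} {C : Type (max u v)} [Fintype V] [Fintype C] (D : SplitAlgebra K A V C)

theorem arr_mul_e_of_ne {a a' : V} (h : a ≠ a') (α : C) (b : V) : D.arr a α b * D.e a' = 0 := by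
  rw [← D.arr_mul_e, mul_assoc, D.e_mul_of_ne h, mul_zero]

theorem arr_eq_zero_of_not_tgt {a b : V} {α : C} (h : ¬ D.Tgt α b) : D.arr a α b = 0 := by
  by_contra h'
  exact h ((D.arr_ne_zero_iff _ _ _).1 h').2

/-! ### Syzygies of the relation modules -/

/-- The relations starting with `α`, as a submodule of the free module on the vertices. -/
def relSpan (α : C) : Submodule A (V → A) :=
  Submodule.span A {y : V → A | ∃ β c, D.rel α β ∧ y = fun b => D.arr b β c}

/-- The direct sum of the modules `A e_b` over all vertices `b` over the end of `α`. -/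
def cover (α : C) : Submodule A (V → A) where
  carrier := {x | ∀ b, x b * D.e b = x b ∧ (¬ D.Tgt α b → x b = 0)}
  add_mem' hx hy b := ⟨by simp [add_mul, (hx b).1, (hy b).1],
    fun h => by simp [(hx b).2 h, (hy b).2 h]⟩
  zero_mem' b := by simp
  smul_mem' r x hx b := ⟨by simp [mul_assoc, (hx b).1], fun h => by simp [(hx b).2 h]⟩

theorem relSpan_le_cover (α : C) : D.relSpan α ≤ D.cover α := by
  refine Submodule.span_le.2 ?_
  rintro _ ⟨β, c, h, rfl⟩ b
  refine ⟨D.arr_mul_e _ _ _, fun hb => ?_⟩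
  by_contra h'
  exact hb ((D.src_iff_tgt h b).1 ((D.arr_ne_zero_iff _ _ _).1 h').1)

open Classical in
/-- The projection of the free module on the vertices onto `D.cover α`. -/
def toCover (α : C) : (V → A) →ₗ[A] D.cover α where
  toFun x := ⟨fun b => if D.Tgt α b then x b * D.e b else 0, fun b => by
    by_cases h : D.Tgt α b <;> simp [h, mul_assoc, D.e_mul_self]⟩
  map_add' x y := by
    ext b
    by_cases h : D.Tgt α b <;> simp [h, add_mul]
  map_smul' r x := by
    ext b
    by_cases h : D.Tgt α b <;> simp [h, mul_assoc]

theorem toCover_coe {α : C} (x : D.cover α) : D.toCover α x = x := by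
  ext b
  by_cases h : D.Tgt α b
  · simp [toCover, h, (x.2 b).1]
  · simp [toCover, h, (x.2 b).2 h]

instance (α : C) : Module.Projective A (D.cover α) :=
  Module.Projective.of_split (D.cover α).subtype (D.toCover α) (by ext1 x; exact D.toCover_coe x)

/-- The map sending a family `x` to `∑ c, x c * arr b β c`, for each `b`. -/
def mulArr (β : C) : D.cover β →ₗ[A] (V → A) where
  toFun x b := ∑ c, x.1 c * D.arr b β c
  map_add' x y := by ext b; simp [add_mul, Finset.sum_add_distrib]
  map_smul' r x := by ext b; simp [mul_assoc, Finset.mul_sum]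

open DirectSum in
/-- The sum of the maps `D.mulArr β` over all `β` satisfying `p`. -/
def sumMulArr (p : C → Prop) : (⨁ β : {β // p β}, D.cover β) →ₗ[A] (V → A) :=
  letI := Classical.decPred p
  ∑ β : {β // p β}, D.mulArr β ∘ₗ DirectSum.component A _ _ β

open DirectSum in
theorem sumMulArr_apply (p : C → Prop) [DecidablePred p] (z : ⨁ β : {β // p β}, D.cover β)
    (b : V) : D.sumMulArr p z b = ∑ β : {β // p β}, ∑ c, (z β).1 c * D.arr b β c := by
  simp only [sumMulArr, LinearMap.sum_apply, Finset.sum_apply, LinearMap.comp_apply]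
  exact Finset.sum_congr (by ext; simp) fun β _ => rfl

theorem sum_mul_arr_of_mem {β : C} {x : V → A} (hx : x ∈ D.relSpan β) (b : V) :
    ∑ c, x c * D.arr b β c = 0 := by
  induction hx using Submodule.span_induction with
  | mem x h =>
    obtain ⟨γ, d, h, rfl⟩ := h
    exact D.sum_arr_mul_arr h b d
  | zero => simp
  | add x y _ _ hx hy => simp [add_mul, Finset.sum_add_distrib, hx, hy]
  | smul r x _ hx => simp [mul_assoc, ← Finset.mul_sum, hx]

open DirectSum in
-- A single coordinate `b` lying over the common start of the classes already determines the kernel,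
-- because `mem_span_of_sum_eq_zero` concerns the arrows at one vertex.
theorem sumMulArr_apply_eq_zero_iff {p : C → Prop} {b : V} (hb : ∀ β, p β → D.Src β b)
    (z : ⨁ β : {β // p β}, D.cover β) :
    D.sumMulArr p z b = 0 ↔ ∀ β : {β // p β}, (z β).1 ∈ D.relSpan β := by
  classical
  rw [sumMulArr_apply]
  constructor
  · intro h β
    -- The family is extended by zero to all classes, as `mem_span_of_sum_eq_zero` sums over all of
    -- them.
    let x : C → V → A := fun α => if hα : p α then (z ⟨α, hα⟩).1 else 0
    have hx : ∀ α (hα : p α), x α = (z ⟨α, hα⟩).1 := fun α hα => by simp [x, hα]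
    have hx0 : ∀ α, ¬ p α → x α = 0 := fun α hα => by simp [x, hα]
    have key := D.mem_span_of_sum_eq_zero b x ?_ ?_ ?_ β (hb _ β.2)
    · rwa [hx _ β.2] at key
    · intro α c
      by_cases hα : p α
      · rw [hx α hα]; exact ((z ⟨α, hα⟩).2 c).1
      · simp [hx0 α hα]
    · intro α c hc
      by_cases hα : p α
      · rw [hx α hα]; exact ((z ⟨α, hα⟩).2 c).2 hc
      · simp [hx0 α hα]
    · rw [← Fintype.sum_subtype_add_sum_subtype p, ← h]
      have h0 : ∀ i : {α // ¬ p α}, ∑ c, x i c * D.arr b i c = 0 := fun i => by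
        simp [hx0 i.1 i.2]
      have h1 : ∀ i : {α // p α}, x i = (z i).1 := fun i => hx i.1 i.2
      simp only [h0, h1, Finset.sum_const_zero, add_zero]
  · intro h
    exact Finset.sum_eq_zero fun β _ => D.sum_mul_arr_of_mem (h β) b

open DirectSum in
-- The kernel hypothesis says that `0 → ⊕ relSpan β → ⊕ cover β → range g → 0` is exact. The middle
-- term is projective, so the dimension goes up by at most one.
theorem PdLE.range_of_relSpan {p : C → Prop} {X : Type (max u v w)} [AddCommGroup X] [Module A X]
    {g : (⨁ β : {β // p β}, D.cover β) →ₗ[A] X}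
    (hg : ∀ z, g z = 0 ↔ ∀ β : {β // p β}, (z β).1 ∈ D.relSpan β) {n : ℕ}
    (h : ∀ β, p β → PdLE A (D.relSpan β) n) : PdLE A (LinearMap.range g) (n + 1) := by
  have h1 : PdLE A (⨁ β : {β // p β}, D.relSpan β) n :=
    PdLE.directSum.{w, max u v} fun β : {β // p β} => h β β.2
  refine PdLE.right (N := ⨁ β : {β // p β}, D.cover β) (f := DirectSum.lmap fun β : {β // p β} =>
    Submodule.inclusion (D.relSpan_le_cover β)) (g := g.rangeRestrict) ?_ ?_ ?_ h1
    (PdLE.of_projective _)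
  · exact (DirectSum.lmap_injective _).2 fun β => Submodule.inclusion_injective _
  · exact g.surjective_rangeRestrict
  · intro z
    have hz : g.rangeRestrict z = 0 ↔ g z = 0 := by
      rw [Subtype.ext_iff]; rfl
    rw [hz, hg]
    constructor
    · intro h
      exact mem_range_lmap _ fun β => ⟨⟨_, h β⟩, rfl⟩
    · rintro ⟨y, rfl⟩ β
      exact (y β).2

open DirectSum in
-- The same exact sequence read from right to left, followed by passing to the direct summand at
-- `β`.
theorem PdLE.relSpan_of_range {p : C → Prop} {X : Type (max u v w)} [AddCommGroup X] [Module A X]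
    {g : (⨁ β : {β // p β}, D.cover β) →ₗ[A] X}
    (hg : ∀ z, g z = 0 ↔ ∀ β : {β // p β}, (z β).1 ∈ D.relSpan β) {n : ℕ}
    (h : PdLE A (LinearMap.range g) (n + 1)) {β : C} (hβ : p β) : PdLE A (D.relSpan β) n := by
  classical
  have h1 : PdLE A (⨁ β : {β // p β}, D.relSpan β) n := by
    refine PdLE.left (N := ⨁ β : {β // p β}, D.cover β) (f := DirectSum.lmap fun β : {β // p β} =>
      Submodule.inclusion (D.relSpan_le_cover β)) (g := g.rangeRestrict) ?_ ?_ ?_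
      (PdLE.of_projective _) h
    · exact (DirectSum.lmap_injective _).2 fun β => Submodule.inclusion_injective _
    · exact g.surjective_rangeRestrict
    · intro z
      have hz : g.rangeRestrict z = 0 ↔ g z = 0 := by
        rw [Subtype.ext_iff]; rfl
      rw [hz, hg]
      constructor
      · intro h
        exact mem_range_lmap _ fun β => ⟨⟨_, h β⟩, rfl⟩
      · rintro ⟨y, rfl⟩ β
        exact (y β).2
  exact h1.of_retract (DirectSum.lof A {β // p β} (fun β => D.relSpan β) ⟨β, hβ⟩)
    (DirectSum.component A {β // p β} (fun β => D.relSpan β) ⟨β, hβ⟩)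
    fun x => DirectSum.component.lof_self A _ _

/-- The generator `e_c` of the summand `cover β` is sent to the row `(arr b β c)_b`, and these rows
span `relSpan α`. -/
theorem range_sumMulArr (α : C) : LinearMap.range (D.sumMulArr (D.rel α)) = D.relSpan α := by
  classical
  apply le_antisymm
  · rintro _ ⟨z, rfl⟩
    have : D.sumMulArr (D.rel α) z =
        ∑ β : {β // D.rel α β}, ∑ c, (z β).1 c • fun b => D.arr b β c := by
      ext b
      simp [sumMulArr_apply]
    rw [this]
    exact Submodule.sum_mem _ fun β _ => Submodule.sum_mem _ fun c _ =>
      Submodule.smul_mem _ _ (Submodule.subset_span ⟨β, c, β.2, rfl⟩)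
  · refine Submodule.span_le.2 ?_
    rintro _ ⟨β, c, h, rfl⟩
    refine ⟨DirectSum.lof A {β // D.rel α β} (fun β => D.cover β) ⟨β, h⟩
      (D.toCover β (Pi.single c (D.e c))), ?_⟩
    ext b
    rw [sumMulArr_apply, Finset.sum_eq_single ⟨β, h⟩, Finset.sum_eq_single c]
    · rw [DirectSum.lof_apply]
      by_cases hc : D.Tgt β c
      · simp [toCover, hc, D.e_mul_self, D.e_mul_arr]
      · simp [D.arr_eq_zero_of_not_tgt hc]
    · intro c' _ hc
      rw [DirectSum.lof_apply]
      simp [toCover, Pi.single_apply, hc]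
    · simp
    · intro β' _ hβ
      erw [DirectSum.of_eq_of_ne _ _ _ hβ]
      simp
    · simp

/-- Every `β` related to `α` starts where `α` ends, so any vertex over the end of `α` can serve as
the test coordinate. -/
theorem sumMulArr_eq_zero_iff (α : C) (z) :
    D.sumMulArr (D.rel α) z = 0 ↔ ∀ β : {β // D.rel α β}, (z β).1 ∈ D.relSpan β := by
  obtain ⟨b, hb⟩ := D.exists_tgt α
  have key := D.sumMulArr_apply_eq_zero_iff (p := D.rel α)
    (fun β hβ => (D.src_iff_tgt hβ b).2 hb) z
  refine ⟨fun h => key.1 (by rw [h]; rfl), fun h => ?_⟩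
  ext b'
  classical
  rw [sumMulArr_apply]
  exact Finset.sum_eq_zero fun β _ => D.sum_mul_arr_of_mem (h β) b'

theorem exists_pdLE_relSpan {α : C} (h : Acc (fun β α => D.rel α β) α) :
    ∃ n, PdLE A (D.relSpan α) n := by
  induction h with
  | intro α _ ih =>
    choose! n hn using ih
    -- The sum is a crude common bound for finitely many dimensions; one more is needed for the
    -- syzygy step.
    refine ⟨(∑ β, n β) + 1, ?_⟩
    rw [← range_sumMulArr]
    exact PdLE.range_of_relSpan D (D.sumMulArr_eq_zero_iff α) fun β hβ => (hn β hβ).mono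
      (Finset.single_le_sum (fun _ _ => Nat.zero_le _) (Finset.mem_univ β))

/-! ### Socles, nilpotency and projective relation modules -/

/-- The submodule of elements annihilated by all arrows. -/
def socle (N : Type*) [AddCommGroup N] [Module A N] : Submodule A N where
  carrier := {x | ∀ a α b, D.arr a α b • x = 0}
  add_mem' hx hy a α b := by rw [smul_add, hx, hy, add_zero]
  zero_mem' a α b := smul_zero _
  smul_mem' r x hx a α b := by
    obtain ⟨k, y, rfl⟩ := D.exists_eq_sum r
    -- Only the idempotent part of the scalar survives on `x`, and an arrow times an idempotent is
    -- that arrow or zero.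
    have h1 : (∑ a, ∑ α, ∑ b, y a α b * D.arr a α b) • x = 0 := by
      simp only [Finset.sum_smul, mul_smul, hx _ _ _, smul_zero, Finset.sum_const_zero]
    rw [add_smul, h1, add_zero, ← mul_smul, Finset.mul_sum, Finset.sum_smul]
    refine Finset.sum_eq_zero fun a' _ => ?_
    rw [mul_smul_comm]
    by_cases h : a = a'
    · subst h
      rw [D.arr_mul_e, Algebra.smul_def, mul_smul, hx, smul_zero]
    · rw [D.arr_mul_e_of_ne h, smul_zero, zero_smul]

/-- All products of `n` arrows annihilate the module. -/
def Annihilates (n : ℕ) (N : Type*) [AddCommGroup N] [Module A N] : Prop :=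
  ∀ (l : List (V × C × V)) (x : N), l.length = n →
    (l.map fun p => D.arr p.1 p.2.1 p.2.2).prod • x = 0

theorem exists_annihilates : ∃ n, ∀ (N : Type (max u v w)) [AddCommGroup N] [Module A N],
    D.Annihilates n N := by
  obtain ⟨n, hn⟩ := D.exists_prod_eq_zero
  exact ⟨n, fun N _ _ l x hl => by rw [hn l hl, zero_smul]⟩

/-- One more arrow on the left of a product of `n` arrows kills `N`, so the product itself maps `N`
into the socle. -/
theorem Annihilates.quotient_socle {n : ℕ} {N : Type*} [AddCommGroup N] [Module A N]
    (h : D.Annihilates (n + 1) N) : D.Annihilates n (N ⧸ D.socle N) := by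
  intro l x hl
  obtain ⟨x, rfl⟩ := Submodule.Quotient.mk_surjective _ x
  rw [← Submodule.Quotient.mk_smul, Submodule.Quotient.mk_eq_zero]
  intro a α b
  have := h ((a, α, b) :: l) x (by simp [hl])
  rwa [List.map_cons, List.prod_cons, mul_smul] at this

theorem Annihilates.subsingleton {N : Type*} [AddCommGroup N] [Module A N]
    (h : D.Annihilates 0 N) : Subsingleton N :=
  subsingleton_of_forall_eq 0 fun x => by simpa using h [] x rfl

/-- Nakayama's lemma for the nilpotent ideal of arrows. If `N` modulo its socle vanishes, all arrows
kill `N`, and then the span of their images is zero. -/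
theorem subsingleton_of_le_span {n : ℕ} {N : Type*} [AddCommGroup N] [Module A N]
    (h : D.Annihilates n N)
    (hN : ⊤ ≤ Submodule.span A {x : N | ∃ a α b y, x = D.arr a α b • y}) : Subsingleton N := by
  induction n generalizing N with
  | zero => exact Annihilates.subsingleton D h
  | succ n ih =>
    have h1 : Subsingleton (N ⧸ D.socle N) := by
      refine ih (Annihilates.quotient_socle D h) ?_
      have := Submodule.map_mono (f := (D.socle N).mkQ) hN
      rw [Submodule.map_top, Submodule.range_mkQ, Submodule.map_span] at this
      refine this.trans (Submodule.span_mono ?_)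
      rintro _ ⟨_, ⟨a, α, b, y, rfl⟩, rfl⟩
      exact ⟨a, α, b, Submodule.Quotient.mk y, rfl⟩
    have h2 : D.socle N = ⊤ := Submodule.Quotient.subsingleton_iff.1 h1
    have h3 : Submodule.span A {x : N | ∃ a α b y, x = D.arr a α b • y} = ⊥ := by
      rw [Submodule.span_eq_bot]
      rintro _ ⟨a, α, b, y, rfl⟩
      exact (h2 ▸ Submodule.mem_top : y ∈ D.socle N) a α b
    rw [h3] at hN
    exact (Submodule.subsingleton_iff A).1 (subsingleton_of_bot_eq_top (le_antisymm bot_le hN))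

/-- The generators of `relSpan β` have arrows as coordinates, so they lie in the radical of `cover
β`. A retraction sends them into the radical of `relSpan β`, and Nakayama's lemma applies. -/
theorem relSpan_eq_bot_of_retraction {β : C} (r : D.cover β →ₗ[A] D.relSpan β)
    (hr : ∀ x, r (Submodule.inclusion (D.relSpan_le_cover β) x) = x) : D.relSpan β = ⊥ := by
  classical
  obtain ⟨n, hn⟩ := D.exists_annihilates
  rw [← Submodule.subsingleton_iff_eq_bot]
  refine D.subsingleton_of_le_span (hn _) ?_
  have key : ∀ x ∈ {y : V → A | ∃ γ d, D.rel β γ ∧ y = fun b => D.arr b γ d},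
      ∃ h : x ∈ D.relSpan β, (⟨x, h⟩ : D.relSpan β) ∈ Submodule.span A
        {x : D.relSpan β | ∃ a α b y, x = D.arr a α b • y} := by
    intro x hx
    have hmem : x ∈ D.relSpan β := Submodule.subset_span hx
    refine ⟨hmem, ?_⟩
    obtain ⟨γ, d, h, rfl⟩ := hx
    -- The row is expanded in the generators `e_c` of `cover β`, with arrows as coefficients.
    have h1 : Submodule.inclusion (D.relSpan_le_cover β) ⟨_, hmem⟩ =
        ∑ c, D.arr c γ d • D.toCover β (Pi.single c (D.e c)) := by
      rw [← D.toCover_coe (Submodule.inclusion (D.relSpan_le_cover β) ⟨_, hmem⟩)]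
      simp only [← map_smul, ← map_sum]
      congr 1
      ext b
      simp [Pi.single_apply, D.arr_mul_e]
    rw [← hr ⟨_, hmem⟩, h1, map_sum]
    simp only [map_smul]
    exact Submodule.sum_mem _ fun c _ => Submodule.subset_span ⟨c, γ, d, _, rfl⟩
  rintro ⟨x, hx⟩ -
  have : ∀ x (hx : x ∈ D.relSpan β), (⟨x, hx⟩ : D.relSpan β) ∈ Submodule.span A
        {x : D.relSpan β | ∃ a α b y, x = D.arr a α b • y} := by
    intro x hx
    induction hx using Submodule.span_induction with
    | mem x h => exact (key x h).2
    | zero => exact Submodule.zero_mem _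
    | add x y _ _ hx hy => exact Submodule.add_mem _ hx hy
    | smul r x _ hx => exact Submodule.smul_mem _ r hx
  exact this x hx

theorem not_rel_of_relSpan_eq_bot {β : C} (h : D.relSpan β = ⊥) (γ : C) : ¬ D.rel β γ := by
  intro hγ
  obtain ⟨c, hc⟩ := D.exists_src γ
  obtain ⟨d, hd⟩ := D.exists_tgt γ
  have : (fun b => D.arr b γ d) ∈ D.relSpan β := Submodule.subset_span ⟨γ, d, hγ, rfl⟩
  rw [h, Submodule.mem_bot] at this
  exact (D.arr_ne_zero_iff c γ d).2 ⟨hc, hd⟩ (congrFun this c)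

open DirectSum in
-- Projectivity splits the presentation of `relSpan α`, so its kernel is a direct summand of `⊕
-- cover β`; restricting to one component gives a retraction onto `relSpan β`.
theorem relSpan_eq_bot_of_projective {α β : C} (h : Module.Projective A (D.relSpan α))
    (hβ : D.rel α β) : D.relSpan β = ⊥ := by
  classical
  rw [← range_sumMulArr] at h
  let g := D.sumMulArr (D.rel α)
  obtain ⟨s, hs⟩ : ∃ s : LinearMap.range g →ₗ[A] ⨁ β : {β // D.rel α β}, D.cover β,
      g.rangeRestrict ∘ₗ s = LinearMap.id :=
    Module.projective_lifting_property g.rangeRestrict LinearMap.id g.surjective_rangeRestrict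
  let i := DirectSum.lof A {β // D.rel α β} (fun β => D.cover β) ⟨β, hβ⟩
  let π := DirectSum.component A {β // D.rel α β} (fun β => D.cover β) ⟨β, hβ⟩
  have hf : ∀ z, g (z - s (g.rangeRestrict z)) = 0 := by
    intro z
    have := congrArg Subtype.val (LinearMap.congr_fun hs (g.rangeRestrict z))
    rw [map_sub, sub_eq_zero]
    exact this.symm
  -- With `s` a section of `g`, the map `z ↦ z - s (g z)` projects onto the kernel of `g`; `r` is
  -- its `β` component on the summand `cover β`.
  let r : D.cover β →ₗ[A] D.relSpan β :=
    LinearMap.codRestrict (D.relSpan β)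
      ((D.cover β).subtype - (D.cover β).subtype ∘ₗ π ∘ₗ s ∘ₗ g.rangeRestrict ∘ₗ i) fun x => by
      have := (D.sumMulArr_eq_zero_iff α _).1 (hf (i x)) ⟨β, hβ⟩
      rw [DirectSum.sub_apply] at this
      simp only [i, DirectSum.lof_apply] at this
      exact this
  refine D.relSpan_eq_bot_of_retraction r ?_
  intro x
  have hx : g (i (Submodule.inclusion (D.relSpan_le_cover β) x)) = 0 := by
    refine (D.sumMulArr_eq_zero_iff α _).2 fun γ => ?_
    by_cases hγ : γ = ⟨β, hβ⟩
    · subst hγ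
      simp [i, DirectSum.lof_apply]
    · simp only [i]
      erw [DirectSum.of_eq_of_ne _ _ _ hγ]
      exact Submodule.zero_mem _
  have hx' : g.rangeRestrict (i (Submodule.inclusion (D.relSpan_le_cover β) x)) = 0 :=
    Subtype.ext hx
  ext1
  change x.1 - (π (s (g.rangeRestrict (i (Submodule.inclusion (D.relSpan_le_cover β) x))))).1 = x.1
  rw [hx', map_zero, map_zero]
  exact sub_zero _

/-- Each related step lowers the bound by one. At bound 0, every `β` related to `α` has `relSpan β =
⊥`, hence no successor. -/
theorem acc_of_pdLE_relSpan {n : ℕ} {α : C} (h : PdLE A (D.relSpan α) n) :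
    Acc (fun β α => D.rel α β) α := by
  induction n generalizing α with
  | zero =>
    refine Acc.intro _ fun β hβ => Acc.intro _ fun γ hγ => ?_
    exact absurd hγ
      (D.not_rel_of_relSpan_eq_bot (D.relSpan_eq_bot_of_projective (pdLE_zero_iff.1 h) hβ) γ)
  | succ n ih =>
    rw [← range_sumMulArr] at h
    exact Acc.intro _ fun β hβ =>
      ih (PdLE.relSpan_of_range D (D.sumMulArr_eq_zero_iff α) h hβ)

/-! ### Radicals, modules killed by arrows, and the global dimension -/

/-- The projective module `A e_a`. -/
def proj (a : V) : Submodule A A where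
  carrier := {x | x * D.e a = x}
  add_mem' hx hy := by
    rw [Set.mem_ofPred_eq] at *
    rw [add_mul, hx, hy]
  zero_mem' := zero_mul _
  smul_mem' r x hx := by
    rw [Set.mem_ofPred_eq] at *
    rw [smul_eq_mul, mul_assoc, hx]

theorem mem_proj {a : V} {x : A} : x ∈ D.proj a ↔ x * D.e a = x := Iff.rfl

instance (a : V) : Module.Projective A (D.proj a) :=
  Module.Projective.of_split (D.proj a).subtype
    (LinearMap.codRestrict (D.proj a) (LinearMap.toSpanSingleton A A (D.e a)) fun x => by
      rw [mem_proj, LinearMap.toSpanSingleton_apply, smul_eq_mul, mul_assoc, D.e_mul_self])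
    (by ext1 x; exact Subtype.ext x.2)

/-- The radical of `A e_a`. -/
def rad (a : V) : Submodule A A :=
  LinearMap.range (LinearMap.proj a ∘ₗ D.sumMulArr fun α => D.Src α a)

theorem rad_le_proj (a : V) : D.rad a ≤ D.proj a := by
  classical
  rintro _ ⟨z, rfl⟩
  rw [mem_proj, LinearMap.comp_apply, LinearMap.proj_apply, sumMulArr_apply]
  simp only [Finset.sum_mul, mul_assoc, D.arr_mul_e]

theorem pdLE_rad {n : ℕ} (h : ∀ α, PdLE A (D.relSpan α) n) (a : V) :
    PdLE A (D.rad a) (n + 1) :=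
  PdLE.range_of_relSpan D (D.sumMulArr_apply_eq_zero_iff fun _ h => h) fun β _ => h β

theorem mul_arr_mem_rad (x : A) (a : V) (α : C) (b : V) : x * D.arr a α b ∈ D.rad a := by
  classical
  by_cases h : D.Src α a ∧ D.Tgt α b
  · rw [← smul_eq_mul]
    refine Submodule.smul_mem _ _ ⟨DirectSum.lof A {α // D.Src α a} (fun α => D.cover α)
      ⟨α, h.1⟩ (D.toCover α (Pi.single b (D.e b))), ?_⟩
    rw [LinearMap.comp_apply, LinearMap.proj_apply, sumMulArr_apply,
      Finset.sum_eq_single ⟨α, h.1⟩, Finset.sum_eq_single b]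
    · rw [DirectSum.lof_apply]
      simp [toCover, h.2, D.e_mul_self, D.e_mul_arr]
    · intro b' _ hb
      rw [DirectSum.lof_apply]
      simp [toCover, Pi.single_apply, hb]
    · simp
    · intro β' _ hβ
      erw [DirectSum.of_eq_of_ne _ _ _ hβ]
      simp
    · simp
  · rw [not_ne_iff.1 (mt (D.arr_ne_zero_iff a α b).1 h), mul_zero]
    exact Submodule.zero_mem _

theorem exists_eq_smul_e_add {a : V} {x : A} (hx : x ∈ D.proj a) :
    ∃ k : K, ∃ y ∈ D.rad a, x = k • D.e a + y := by
  obtain ⟨k, y, rfl⟩ := D.exists_eq_sum x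
  refine ⟨k a, ∑ α, ∑ b, y a α b * D.arr a α b, Submodule.sum_mem _ fun α _ =>
    Submodule.sum_mem _ fun b _ => D.mul_arr_mem_rad _ a α b, ?_⟩
  rw [mem_proj] at hx
  rw [← hx, add_mul, Finset.sum_mul, Finset.sum_mul]
  congr 1
  · rw [Finset.sum_eq_single a, smul_mul_assoc, D.e_mul_self]
    · intro b _ hb
      rw [smul_mul_assoc, D.e_mul_of_ne hb, smul_zero]
    · simp
  · rw [Finset.sum_eq_single a]
    · simp only [Finset.sum_mul, mul_assoc, D.arr_mul_e]
    · intro b _ hb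
      simp only [Finset.sum_mul, mul_assoc, D.arr_mul_e_of_ne hb, mul_zero, Finset.sum_const_zero]
    · simp

theorem smul_eq_zero_of_mem_rad {N : Type*} [AddCommGroup N] [Module A N]
    (hN : ∀ (x : N) a α b, D.arr a α b • x = 0) {a : V} {y : A} (hy : y ∈ D.rad a) (x : N) :
    y • x = 0 := by
  classical
  obtain ⟨z, rfl⟩ := hy
  rw [LinearMap.comp_apply, LinearMap.proj_apply, sumMulArr_apply]
  simp only [Finset.sum_smul, mul_smul, hN, smul_zero, Finset.sum_const_zero]

open DirectSum in
-- Such a module is a direct sum of copies of the modules `A e_a / rad a`: a basis over `K` adapted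
-- to the idempotents gives a cover by `⊕ A e_a` with kernel `⊕ rad a`.
theorem pdLE_of_arr_smul_eq_zero {n : ℕ} (h : ∀ α, PdLE A (D.relSpan α) n)
    {N : Type (max u v w)} [AddCommGroup N] [Module A N]
    (hN : ∀ (x : N) a α b, D.arr a α b • x = 0) : PdLE A N (n + 2) := by
  classical
  let : Module K N := Module.compHom N (algebraMap K A)
  have hK : ∀ (k : K) (x : N), k • x = algebraMap K A k • x := fun _ _ => rfl
  let s : Set N := {x | ∃ a, D.e a • x = x}
  -- The vectors fixed by some idempotent span `N`, as the idempotents sum to 1; so a basis can be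
  -- chosen among them.
  obtain ⟨ι, hιs, hspan, hind⟩ := exists_linearIndependent K s
  have htop : Submodule.span K (ι : Set N) = ⊤ := by
    rw [hspan, eq_top_iff]
    intro x _
    rw [← one_smul A x, ← D.sum_e, Finset.sum_smul]
    exact Submodule.sum_mem _ fun a _ =>
      Submodule.subset_span ⟨a, by rw [← mul_smul, D.e_mul_self]⟩
  choose a ha using fun i : ι => hιs i.2
  let g : (⨁ i : ι, D.proj (a i)) →ₗ[A] N := DirectSum.toModule A ι N fun i =>
    LinearMap.toSpanSingleton A N i.1 ∘ₗ (D.proj (a i)).subtype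
  have hgapp : ∀ z, g z = ∑ i ∈ z.support, (z i).1 • i.1 := fun z => by
    conv_lhs => rw [← DirectSum.sum_support_of z]
    rw [map_sum]
    refine Finset.sum_congr rfl fun i _ => ?_
    erw [DirectSum.toModule_lof]
    rfl
  have hgsurj : Function.Surjective g := by
    have h1 : ∀ i : ι, i.1 ∈ LinearMap.range g := fun i =>
      ⟨DirectSum.lof A ι (fun i => D.proj (a i)) i ⟨D.e (a i), D.e_mul_self _⟩, by
        rw [DirectSum.toModule_lof]
        exact ha i⟩
    have h2 : ∀ x ∈ Submodule.span K (ι : Set N), x ∈ LinearMap.range g := by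
      intro x hx
      induction hx using Submodule.span_induction with
      | mem x h => exact h1 ⟨x, h⟩
      | zero => exact Submodule.zero_mem _
      | add x y _ _ hx hy => exact Submodule.add_mem _ hx hy
      | smul r x _ hx => exact Submodule.smul_mem _ (algebraMap K A r) hx
    intro x
    exact h2 x (htop ▸ Submodule.mem_top)
  have hpd : PdLE A (⨁ i : ι, D.rad (a i)) (n + 1) :=
    PdLE.directSum.{max u v w, max u v w} fun i : ι => D.pdLE_rad h (a i)
  refine PdLE.right (N := ⨁ i : ι, D.proj (a i)) (f := DirectSum.lmap fun i : ι =>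
    Submodule.inclusion (D.rad_le_proj (a i))) (g := g) ?_ hgsurj ?_ hpd (PdLE.of_projective _)
  · exact (DirectSum.lmap_injective _).2 fun β => Submodule.inclusion_injective _
  · intro z
    constructor
    · intro hz
      choose k y hy hxy using fun i => D.exists_eq_smul_e_add (z i).2
      have h1 : ∀ i, (z i).1 • i.1 = k i • i.1 := fun i => by
        rw [hxy, add_smul, D.smul_eq_zero_of_mem_rad hN (hy i), add_zero, Algebra.smul_def,
          mul_smul, ha, hK]
      rw [hgapp] at hz
      simp only [h1] at hz
      -- Linear independence kills the coefficient of `e_a` in each component, which leaves only the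
      -- radical part.
      have hk := linearIndependent_iff'.1 hind _ _ hz
      refine mem_range_lmap _ fun i => ⟨⟨(z i).1, ?_⟩, rfl⟩
      by_cases hi : i ∈ z.support
      · rw [hxy, hk i hi, zero_smul, zero_add]
        exact hy i
      · rw [DFinsupp.notMem_support_iff.1 hi]
        exact Submodule.zero_mem _
    · rintro ⟨y, rfl⟩
      rw [hgapp]
      exact Finset.sum_eq_zero fun i _ => D.smul_eq_zero_of_mem_rad hN (y i).2 _

/-- Induction along the socle series: extensions of modules of dimension at most `n + 2` obey the
same bound. -/
theorem pdLE_of_annihilates {n : ℕ} (h : ∀ α, PdLE A (D.relSpan α) n) {m : ℕ}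
    {N : Type (max u v w)} [AddCommGroup N] [Module A N] (hN : D.Annihilates m N) :
    PdLE A N (n + 2) := by
  induction m generalizing N with
  | zero =>
    have := Annihilates.subsingleton D hN
    exact PdLE.of_projective _
  | succ m ih =>
    exact PdLE.middle (Submodule.injective_subtype (D.socle N)) (Submodule.mkQ_surjective _)
      (LinearMap.exact_subtype_mkQ _)
      (D.pdLE_of_arr_smul_eq_zero h fun x a α b => Subtype.ext (x.2 a α b))
      (ih (Annihilates.quotient_socle D hN))

theorem globalDimension_lt_top_iff :
    globalDimension A < ⊤ ↔ ∀ α, Acc (fun β α => D.rel α β) α := by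
  rw [SkewedGentle.globalDimension_lt_top_iff]
  constructor
  · rintro ⟨d, hd⟩ α
    exact D.acc_of_pdLE_relSpan (hd (D.relSpan α))
  · intro h
    choose n hn using fun α => D.exists_pdLE_relSpan (h α)
    obtain ⟨m, hm⟩ := D.exists_annihilates
    refine ⟨(∑ α, n α) + 2, fun M _ _ => D.pdLE_of_annihilates (fun α => (hn α).mono ?_) (hm M)⟩
    exact Finset.single_le_sum (fun _ _ => Nat.zero_le _) (Finset.mem_univ α)

end SplitAlgebra

/-! ### The universal property of the path algebra -/

namespace PathAlgebra

section Lift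

variable {K : Type w} {Q : Type u} [Field K] [Quiver.{v} Q] {B : Type*} [Ring B] [Algebra K B]

/-- The value of a path, given the values of the vertices and of the arrows. -/
def evalPath (E : Q → B) (T : ∀ ⦃a b : Q⦄, (a ⟶ b) → B) {a : Q} :
    ∀ {b : Q}, Quiver.Path a b → B
  | _, .nil => E a
  | _, .cons p e => T e * evalPath E T p

theorem ofPath_cons {a b c : Q} (p : Quiver.Path a b) (e : b ⟶ c) :
    mulHom K (ofArrow K e) (ofPath K ⟨a, b, p⟩) = ofPath K ⟨a, c, p.cons e⟩ := by
  rw [ofArrow, mulHom_ofPath]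
  simp [mulPath, AnyPath.concat, Quiver.Hom.toPath, Quiver.Path.comp]

theorem ofArrow_mul_ofPath {a b c : Q} (p : Quiver.Path a b) (e : b ⟶ c) :
    ofArrow K e * ofPath K ⟨a, b, p⟩ = ofPath K ⟨a, c, p.cons e⟩ :=
  ofPath_cons p e

theorem idem_mul_idem_self (a : Q) : idem K a * idem K a = idem K a := by
  classical
  exact (idem_mul_ofPath a _).trans (if_pos rfl)

theorem idem_mul_idem_of_ne {a b : Q} (h : a ≠ b) : idem K a * idem K b = 0 := by
  classical
  exact (idem_mul_ofPath a _).trans (if_neg h.symm)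

theorem idem_mul_ofArrow {a b : Q} (e : a ⟶ b) : idem K b * ofArrow K e = ofArrow K e := by
  classical
  exact (idem_mul_ofPath b _).trans (if_pos rfl)

theorem ofArrow_mul_idem {a b : Q} (e : a ⟶ b) : ofArrow K e * idem K a = ofArrow K e := by
  classical
  exact (ofPath_mul_idem a _).trans (if_pos rfl)

theorem induction_on {p : PathAlgebra K Q → Prop} (x : PathAlgebra K Q) (h0 : p 0)
    (hadd : ∀ x y, p x → p y → p (x + y)) (hsmul : ∀ (k : K) x, p x → p (k • x))
    (hidem : ∀ a, p (idem K a))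
    (harr : ∀ {a b : Q} (e : a ⟶ b) x, p x → p (ofArrow K e * x)) : p x := by
  have hpath : ∀ {a b : Q} (q : Quiver.Path a b), p (ofPath K ⟨a, b, q⟩) := by
    intro a b q
    induction q with
    | nil => exact hidem a
    | cons q e ih => rw [← ofArrow_mul_ofPath]; exact harr e _ ih
  refine Finsupp.induction_linear (motive := p) x h0 hadd fun q k => ?_
  have : (Finsupp.single q k : AnyPath Q →₀ K) = (k • ofPath K q : PathAlgebra K Q) := by
    change _ = k • (Finsupp.single q (1 : K) : AnyPath Q →₀ K)
    rw [Finsupp.smul_single, smul_eq_mul, mul_one]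
  rw [this]
  exact hsmul _ _ (hpath q.2.2)

variable {E : Q → B} {T : ∀ ⦃a b : Q⦄, (a ⟶ b) → B}

theorem evalPath_mul_idem (hE : ∀ a, E a * E a = E a) {a b : Q} (p : Quiver.Path a b) :
    evalPath E T p * E a = evalPath E T p := by
  induction p with
  | nil => exact hE a
  | cons p e ih => rw [evalPath, mul_assoc, ih]

theorem idem_mul_evalPath (hE : ∀ a, E a * E a = E a)
    (hTE : ∀ ⦃a b : Q⦄ (e : a ⟶ b), E b * T e = T e) {a b : Q} (p : Quiver.Path a b) :
    E b * evalPath E T p = evalPath E T p := by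
  cases p with
  | nil => exact hE a
  | cons p e => rw [evalPath, ← mul_assoc, hTE]

theorem evalPath_comp (hE : ∀ a, E a * E a = E a)
    (hTE : ∀ ⦃a b : Q⦄ (e : a ⟶ b), E b * T e = T e) {a b c : Q} (p : Quiver.Path a b)
    (q : Quiver.Path b c) : evalPath E T (p.comp q) = evalPath E T q * evalPath E T p := by
  induction q with
  | nil => rw [Quiver.Path.comp_nil, evalPath, idem_mul_evalPath hE hTE]
  | cons q e ih => rw [Quiver.Path.comp_cons, evalPath, ih, evalPath, mul_assoc]

variable [Finite Q]

variable (K) in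
/-- The algebra homomorphism determined by orthogonal idempotents `E` and images `T` of arrows. -/
def lift (E : Q → B) (T : ∀ ⦃a b : Q⦄, (a ⟶ b) → B) (hE : ∀ a, E a * E a = E a)
    (hE' : ∀ ⦃a b⦄, a ≠ b → E a * E b = 0)
    (h1 : letI := Fintype.ofFinite Q; ∑ a, E a = 1)
    (hTE : ∀ ⦃a b : Q⦄ (e : a ⟶ b), E b * T e = T e) : PathAlgebra K Q →ₐ[K] B :=
  let φ : PathAlgebra K Q →ₗ[K] B :=
    Finsupp.linearCombination K fun p : AnyPath Q => evalPath E T p.2.2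
  have hφ : ∀ p : AnyPath Q, φ (ofPath K p) = evalPath E T p.2.2 := fun p =>
    (Finsupp.linearCombination_single K _ _).trans (one_smul _ _)
  AlgHom.ofLinearMap φ
    (by
      rw [one_def, map_sum, ← h1]
      exact Finset.sum_congr rfl fun a _ => hφ _)
    (by
      have key : (LinearMap.compr₂ (mulHom K) φ) = (LinearMap.mul K B).compl₁₂ φ φ := by
        refine hom_ext fun p => hom_ext fun q => ?_
        obtain ⟨a, b, p⟩ := p
        obtain ⟨c, d, q⟩ := q
        simp only [LinearMap.compr₂_apply, LinearMap.compl₁₂_apply, LinearMap.mul_apply', hφ]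
        rw [mulHom_ofPath, mulPath]
        split_ifs with h
        · obtain rfl : d = a := h
          rw [hφ, ← evalPath_comp hE hTE]
          rfl
        -- For paths that do not compose, the idempotents at the mismatched ends are inserted
        -- between the two values and multiply to zero.
        · rw [map_zero, ← evalPath_mul_idem hE p, ← idem_mul_evalPath hE hTE q, mul_assoc,
            ← mul_assoc (E a), hE' (Ne.symm h), zero_mul, mul_zero]
      intro x y
      exact LinearMap.congr_fun (LinearMap.congr_fun key x) y)

section

variable (hE : ∀ a, E a * E a = E a)
    (hE' : ∀ ⦃a b⦄, a ≠ b → E a * E b = 0)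
    (h1 : letI := Fintype.ofFinite Q; ∑ a, E a = 1)
    (hTE : ∀ ⦃a b : Q⦄ (e : a ⟶ b), E b * T e = T e)

theorem lift_ofPath (p : AnyPath Q) :
    lift K E T hE hE' h1 hTE (ofPath K p) = evalPath E T p.2.2 :=
  (Finsupp.linearCombination_single K _ _).trans (one_smul _ _)

theorem lift_idem (a : Q) : lift K E T hE hE' h1 hTE (idem K a) = E a :=
  lift_ofPath ..

theorem lift_ofArrow (hET : ∀ ⦃a b : Q⦄ (e : a ⟶ b), T e * E a = T e) {a b : Q} (e : a ⟶ b) :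
    lift K E T hE hE' h1 hTE (ofArrow K e) = T e :=
  (lift_ofPath ..).trans (hET e)

end

end Lift

end PathAlgebra

/-! ### Quivers over a base -/

/-- A quiver `V` with vertices lying over the elements of `B`, such that each arrow has a class
in `C`, and is determined by its ends and its class. -/
structure QuiverCover (V : Type u) [Quiver.{v} V] (C : Type (max u v)) (B : Type*) where
  base : V → B
  src : C → B
  tgt : C → B
  cls : ∀ {a b : V}, (a ⟶ b) → C
  base_surjective : Function.Surjective base
  cls_injective (a b : V) : Function.Injective (cls : (a ⟶ b) → C)
  src_cls {a b : V} (e : a ⟶ b) : src (cls e) = base a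
  tgt_cls {a b : V} (e : a ⟶ b) : tgt (cls e) = base b
  exists_cls {a b : V} {α : C} (ha : src α = base a) (hb : tgt α = base b) :
    ∃ e : a ⟶ b, cls e = α

namespace QuiverCover

variable (K : Type w) [Field K] {V : Type u} [Quiver.{v} V] {C : Type (max u v)} {B : Type*}
  (D : QuiverCover V C B)

open Classical in
/-- The arrow from `a` to `b` in the class `α` as an element of the path algebra, and zero if
there is no such arrow. -/
def arrow (a : V) (α : C) (b : V) : PathAlgebra K V :=
  if h : ∃ e : a ⟶ b, D.cls e = α then PathAlgebra.ofArrow K h.choose else 0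

theorem arrow_cls {a b : V} (e : a ⟶ b) : D.arrow K a (D.cls e) b = PathAlgebra.ofArrow K e := by
  have h : ∃ e' : a ⟶ b, D.cls e' = D.cls e := ⟨e, rfl⟩
  rw [arrow, dif_pos h, D.cls_injective a b h.choose_spec]

theorem arrow_eq_zero {a b : V} {α : C} (h : ¬ (D.src α = D.base a ∧ D.tgt α = D.base b)) :
    D.arrow K a α b = 0 := by
  refine dif_neg ?_
  rintro ⟨e, rfl⟩
  exact h ⟨D.src_cls e, D.tgt_cls e⟩

theorem arrow_cases (a : V) (α : C) (b : V) :
    (∃ e : a ⟶ b, D.cls e = α) ∨ D.arrow K a α b = 0 := by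
  by_cases h : ∃ e : a ⟶ b, D.cls e = α
  · exact Or.inl h
  · exact Or.inr (dif_neg h)

theorem idem_mul_arrow [Finite V] (a : V) (α : C) (b : V) :
    PathAlgebra.idem K b * D.arrow K a α b = D.arrow K a α b := by
  obtain ⟨e, rfl⟩ | h := D.arrow_cases K a α b
  · rw [arrow_cls, PathAlgebra.idem_mul_ofArrow]
  · rw [h, mul_zero]

theorem arrow_mul_idem [Finite V] (a : V) (α : C) (b : V) :
    D.arrow K a α b * PathAlgebra.idem K a = D.arrow K a α b := by
  obtain ⟨e, rfl⟩ | h := D.arrow_cases K a α b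
  · rw [arrow_cls, PathAlgebra.ofArrow_mul_idem]
  · rw [h, zero_mul]

end QuiverCover

namespace QuiverCover

/-! ### Relations and the bound quiver algebra -/

section Relations

variable {K : Type w} [Field K] {V : Type u} [Quiver.{v} V] {C : Type (max u v)} {B : Type*}
  (D : QuiverCover V C B) [Fintype V]

/-- The relation `∑ b, c b • (b, β, d)(a, α, b)`. -/
def relation (c : V → K) (a : V) (α β : C) (d : V) : PathAlgebra K V :=
  ∑ b, c b • (D.arrow K b β d * D.arrow K a α b)

variable {c : V → K} {I : C → C → Prop} {R : Set (PathAlgebra K V)}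

variable (R) in
/-- The projection onto the bound quiver algebra. -/
abbrev toBound : PathAlgebra K V →ₐ[K] BoundQuiverAlgebra K R :=
  (TwoSidedIdeal.span R).ringCon.mkₐ K

theorem toBound_eq_zero {x : PathAlgebra K V} (hx : x ∈ TwoSidedIdeal.span R) : toBound R x = 0 :=
  (RingCon.eq _).2 hx

/-- A homomorphism from the path algebra that vanishes on relations factors through the
bound quiver algebra. -/
def desc {B : Type*} [Ring B] [Algebra K B] (f : PathAlgebra K V →ₐ[K] B)
    (hf : ∀ x ∈ R, f x = 0) : BoundQuiverAlgebra K R →ₐ[K] B :=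
  RingCon.liftₐ _ f (by
    have h : TwoSidedIdeal.span R ≤ TwoSidedIdeal.ker f :=
      TwoSidedIdeal.span_le.2 fun x hx => (TwoSidedIdeal.mem_ker f).2 (hf x hx)
    exact TwoSidedIdeal.ringCon_le_iff.1 h)

theorem toBound_surjective : Function.Surjective (toBound R) := RingCon.mk'_surjective _

end Relations

/-! ### A module detecting linear relations between arrows -/

section Detect

variable {K : Type w} [Field K] {V : Type u} [Quiver.{v} V] {C : Type (max u v)} {B : Type*}
  (D : QuiverCover V C B) [Fintype V]
variable {A : Type*} [Ring A] [Algebra K A] (q : PathAlgebra K V →ₐ[K] A)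

variable (c : V → K) (I : C → C → Prop)

/-- The relations starting with `α`. -/
def relSpan (α : C) : Submodule A (V → A) :=
  Submodule.span A {y : V → A | ∃ β d, I α β ∧ y = fun b => c b • q (D.arrow K b β d)}

/-- The direct sum of the quotients by the relations. -/
def Detector : Type _ := ∀ α : C, (V → A) ⧸ D.relSpan q c I α

instance : AddCommGroup (D.Detector q c I) :=
  inferInstanceAs (AddCommGroup (∀ α : C, (V → A) ⧸ D.relSpan q c I α))

instance : Module A (D.Detector q c I) :=
  inferInstanceAs (Module A (∀ α : C, (V → A) ⧸ D.relSpan q c I α))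

instance : Module K (D.Detector q c I) :=
  inferInstanceAs (Module K (∀ α : C, (V → A) ⧸ D.relSpan q c I α))

instance : IsScalarTower K A (D.Detector q c I) :=
  inferInstanceAs (IsScalarTower K A (∀ α : C, (V → A) ⧸ D.relSpan q c I α))

open Classical in
/-- The map into the component of `α`. -/
def toDetector (α : C) : (V → A) →ₗ[A] D.Detector q c I :=
  LinearMap.single A (fun α : C => (V → A) ⧸ D.relSpan q c I α) α ∘ₗ (D.relSpan q c I α).mkQ

/-- The projection to the component of `α`. -/
def detectorProj (α : C) : D.Detector q c I →ₗ[A] (V → A) ⧸ D.relSpan q c I α :=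
  LinearMap.proj (φ := fun α : C => (V → A) ⧸ D.relSpan q c I α) α

theorem detectorProj_toDetector_self (α : C) (x : V → A) :
    D.detectorProj q c I α (D.toDetector q c I α x) = Submodule.Quotient.mk x := by
  classical
  exact Pi.single_eq_same (M := fun α : C => (V → A) ⧸ D.relSpan q c I α) α _

theorem detectorProj_toDetector_of_ne {α β : C} (h : α ≠ β) (x : V → A) :
    D.detectorProj q c I α (D.toDetector q c I β x) = 0 := by
  classical
  exact Pi.single_eq_of_ne (M := fun α : C => (V → A) ⧸ D.relSpan q c I α) h _

theorem toDetector_eq_zero {α : C} {x : V → A} (hx : x ∈ D.relSpan q c I α) :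
    D.toDetector q c I α x = 0 := by
  classical
  change Pi.single (M := fun α : C => (V → A) ⧸ D.relSpan q c I α) α (Submodule.Quotient.mk x) = 0
  rw [(Submodule.Quotient.mk_eq_zero _).2 hx, Pi.single_zero]

open Classical in
/-- The generator attached to the arrow from `a` to `b` in the class `α`. -/
def generator (a : V) (α : C) (b : V) : D.Detector q c I :=
  if D.src α = D.base a ∧ D.tgt α = D.base b then
    D.toDetector q c I α (Pi.single b (q (PathAlgebra.idem K b))) else 0

open Classical in
/-- The action of the trivial path at `b` on `K × D.Detector`. -/
def vertexAct (a b : V) : Module.End K (K × D.Detector q c I) :=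
  LinearMap.prodMap (if a = b then LinearMap.id else 0)
    (Algebra.lsmul K K _ (q (PathAlgebra.idem K b)))

open Classical in
/-- The action of an arrow on `K × D.Detector`. -/
def arrowAct (a : V) (a' : V) (α : C) (b : V) : Module.End K (K × D.Detector q c I) :=
  LinearMap.inr K K _ ∘ₗ (Algebra.lsmul K K _ (q (D.arrow K a' α b)) ∘ₗ LinearMap.snd K K _ +
    LinearMap.toSpanSingleton K _ (if a = a' then D.generator q c I a α b else 0) ∘ₗ
      LinearMap.fst K K _)

theorem arrowAct_apply (a a' : V) (α : C) (b : V) (x : K × D.Detector q c I) [Decidable (a = a')] :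
    D.arrowAct q c I a a' α b x = (0, q (D.arrow K a' α b) • x.2 +
      x.1 • (if a = a' then D.generator q c I a α b else 0)) := by
  simp only [arrowAct]
  split_ifs <;> simp

theorem vertexAct_apply (a b : V) (x : K × D.Detector q c I) [Decidable (a = b)] :
    D.vertexAct q c I a b x =
      (if a = b then x.1 else 0, q (PathAlgebra.idem K b) • x.2) := by
  simp only [vertexAct]
  split_ifs <;> rfl

theorem idem_smul_generator (a : V) (α : C) (b : V) :
    q (PathAlgebra.idem K b) • D.generator q c I a α b = D.generator q c I a α b := by
  classical
  rw [generator]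
  split_ifs
  · rw [← map_smul, ← Pi.single_smul, smul_eq_mul, ← map_mul, PathAlgebra.idem_mul_idem_self]
  · rw [smul_zero]

/-- The sum is the class of the row `(c b • q (b, β, d))_b` in the component of `α`, and exactly
these rows have been divided out there. -/
theorem sum_smul_generator (hI : ∀ α β, I α β → D.tgt α = D.src β) {α β : C} (h : I α β)
    (a d : V) : ∑ b, c b • (q (D.arrow K b β d) • D.generator q c I a α b) = 0 := by
  classical
  by_cases ha : D.src α = D.base a
  · have h1 : ∀ b, c b • (q (D.arrow K b β d) • D.generator q c I a α b) =
        D.toDetector q c I α (Pi.single b (c b • q (D.arrow K b β d))) := by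
      intro b
      rw [generator]
      by_cases hb : D.tgt α = D.base b
      · rw [if_pos ⟨ha, hb⟩, ← map_smul, ← Pi.single_smul, smul_eq_mul, ← map_mul, arrow_mul_idem,
          ← LinearMap.map_smul_of_tower, ← Pi.single_smul]
      · rw [if_neg (fun h => hb h.2), D.arrow_eq_zero K (fun h' => hb ((hI _ _ h).trans h'.1))]
        simp
    rw [Finset.sum_congr rfl fun b _ => h1 b, ← map_sum, Finset.univ_sum_single]
    exact D.toDetector_eq_zero q c I (Submodule.subset_span ⟨β, d, h, rfl⟩)
  · have h1 : ∀ b, D.generator q c I a α b = 0 := fun b => if_neg fun h => ha h.1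
    simp [h1]

end Detect

end QuiverCover

namespace QuiverCover

/-! ### The representation on `K × D.Detector` -/

section Detect

variable {K : Type w} [Field K] {V : Type u} [Quiver.{v} V] {C : Type (max u v)} {B : Type*}
  (D : QuiverCover V C B) [Fintype V]
variable {A : Type*} [Ring A] [Algebra K A] (q : PathAlgebra K V →ₐ[K] A)

variable (c : V → K) (I : C → C → Prop)

/-- The action of the path algebra on `K × D.Detector`. -/
def detectorAct (a : V) : PathAlgebra K V →ₐ[K] Module.End K (K × D.Detector q c I) :=
  PathAlgebra.lift K (D.vertexAct q c I a) (fun a' b e => D.arrowAct q c I a a' (D.cls e) b)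
    (fun b => by
      classical
      refine LinearMap.ext fun x => ?_
      rw [Module.End.mul_apply]
      simp only [vertexAct_apply, ← mul_smul, ← map_mul, PathAlgebra.idem_mul_idem_self]
      split_ifs <;> rfl)
    (fun b b' h => by
      classical
      refine LinearMap.ext fun x => ?_
      rw [Module.End.mul_apply]
      simp only [vertexAct_apply, ← mul_smul, ← map_mul, PathAlgebra.idem_mul_idem_of_ne h,
        map_zero, zero_smul, LinearMap.zero_apply]
      by_cases h1 : a = b
      · rw [if_neg fun h2 => h (h1.symm.trans h2), ite_self]
        rfl
      · rw [if_neg h1]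
        rfl)
    (by
      classical
      refine LinearMap.ext fun x => ?_
      simp only [LinearMap.sum_apply, vertexAct_apply, Module.End.one_apply]
      refine Prod.ext ?_ ?_
      · rw [Prod.fst_sum]
        simp
      · rw [Prod.snd_sum]
        simp only
        rw [← Finset.sum_smul, ← map_sum, ← PathAlgebra.one_def, map_one, one_smul])
    (fun a' b e => by
      classical
      refine LinearMap.ext fun x => ?_
      rw [Module.End.mul_apply]
      simp only [vertexAct_apply, arrowAct_apply, smul_add, ← mul_smul, ← map_mul, idem_mul_arrow,
        ite_self]
      rw [smul_comm]
      split_ifs with h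
      · subst h
        rw [idem_smul_generator]
      · rw [smul_zero])

theorem detectorAct_arrow (a a' : V) (α : C) (b : V) :
    D.detectorAct q c I a (D.arrow K a' α b) = D.arrowAct q c I a a' α b := by
  classical
  by_cases h : D.src α = D.base a' ∧ D.tgt α = D.base b
  · obtain ⟨e, rfl⟩ := D.exists_cls h.1 h.2
    rw [arrow_cls]
    refine PathAlgebra.lift_ofArrow _ _ _ _ (fun a' b e => ?_) e
    refine LinearMap.ext fun x => ?_
    rw [Module.End.mul_apply]
    simp only [vertexAct_apply, arrowAct_apply, ← mul_smul, ← map_mul, arrow_mul_idem]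
    split_ifs <;> simp
  · rw [D.arrow_eq_zero K h, map_zero]
    refine LinearMap.ext fun x => ?_
    rw [arrowAct_apply, D.arrow_eq_zero K h, map_zero, zero_smul, zero_add]
    split_ifs with ha
    · subst ha
      rw [generator, if_neg h, smul_zero]
      rfl
    · rw [smul_zero]
      rfl

theorem detectorAct_apply_zero (a : V) (y : PathAlgebra K V) (m : D.Detector q c I) :
    D.detectorAct q c I a y (0, m) = (0, q y • m) := by
  classical
  induction y using PathAlgebra.induction_on with
  | h0 => rw [map_zero, map_zero, zero_smul]; rfl
  | hadd x y hx hy => rw [map_add, LinearMap.add_apply, hx, hy, map_add, add_smul]; simp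
  | hsmul k x hx => rw [map_smul, LinearMap.smul_apply, hx, map_smul, smul_assoc]; simp
  | hidem b =>
    rw [detectorAct, PathAlgebra.lift_idem, vertexAct_apply, ite_self]
  | harr e x hx =>
    rw [map_mul, Module.End.mul_apply, hx, ← D.arrow_cls K, detectorAct_arrow, arrowAct_apply,
      zero_smul, add_zero, map_mul, mul_smul]

/-- On the detector the relation acts through `q`, hence by zero; on the added vector `(1, 0)` it
gives the sum in `sum_smul_generator`, or trivially zero when `a ≠ a'`. -/
theorem detectorAct_relation (hI : ∀ α β, I α β → D.tgt α = D.src β) {α β : C} (h : I α β)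
    (a a' d : V) (hq : q (D.relation c a' α β d) = 0) :
    D.detectorAct q c I a (D.relation c a' α β d) = 0 := by
  classical
  refine LinearMap.ext fun x => ?_
  simp only [relation, map_sum, map_smul, map_mul, LinearMap.sum_apply, LinearMap.smul_apply,
    Module.End.mul_apply, detectorAct_arrow]
  simp only [arrowAct_apply, zero_smul, add_zero, smul_add, ← mul_smul, ← map_mul]
  refine Prod.ext ?_ ?_
  · rw [Prod.fst_sum]
    simp
  · rw [Prod.snd_sum]
    simp only [Prod.smul_snd, smul_add, Finset.sum_add_distrib, LinearMap.zero_apply,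
      Prod.snd_zero]
    have h1 : ∑ b, c b • q (D.arrow K b β d * D.arrow K a' α b) • x.2 = 0 := by
      simp only [← smul_assoc, ← map_smul, ← Finset.sum_smul, ← map_sum]
      rw [relation] at hq
      rw [hq, zero_smul]
    rw [h1, zero_add]
    by_cases ha : a = a'
    · subst ha
      simp only [if_true]
      have h2 := congrArg (x.1 • ·) (D.sum_smul_generator q c I hI h a d)
      simp only [Finset.smul_sum, smul_zero] at h2
      rw [← h2]
      refine Finset.sum_congr rfl fun b _ => ?_
      rw [smul_comm (x.1), smul_comm (x.1)]
    · simp [ha]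

end Detect

/-! ### Linear relations between arrows of the bound quiver algebra -/

section Bound

variable {K : Type w} [Field K] {V : Type u} [Quiver.{v} V] {C : Type (max u v)} {B : Type*}
  (D : QuiverCover V C B) [Fintype V] [Fintype C]
variable {c : V → K} {I : C → C → Prop} {R : Set (PathAlgebra K V)}

/-- The representation factors through the bound quiver algebra. Applying the vanishing sum to `(1,
0)` gives, in the component of each `α` starting under `a`, the class of `c a • x α` modulo `relSpan
α`; hence this class is zero. -/
theorem mem_relSpan_of_sum_eq_zero (hc : ∀ a, c a ≠ 0)
    (hI : ∀ α β, I α β → D.tgt α = D.src β)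
    (hR : ∀ x ∈ R, ∃ a α β d, I α β ∧ x = D.relation c a α β d)
    (a : V) (x : C → V → BoundQuiverAlgebra K R)
    (hx : ∀ α b, x α b * toBound R (PathAlgebra.idem K b) = x α b)
    (hx' : ∀ α b, ¬ D.tgt α = D.base b → x α b = 0)
    (h : ∑ α, ∑ b, x α b * (c a • toBound R (D.arrow K a α b)) = 0) (α : C)
    (hα : D.src α = D.base a) : x α ∈ D.relSpan (toBound R) c I α := by
  classical
  let q := toBound R
  have hact : ∀ x ∈ R, D.detectorAct q c I a x = 0 := by
    intro x hx
    have hq := toBound_eq_zero (TwoSidedIdeal.subset_span hx)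
    obtain ⟨a', α, β, d, hαβ, rfl⟩ := hR x hx
    exact D.detectorAct_relation q c I hI hαβ a a' d hq
  let Φ := desc (R := R) (D.detectorAct q c I a) hact
  have h1 : ∀ α b, Φ (x α b * (c a • q (D.arrow K a α b))) (1, 0) =
      (0, x α b • (c a • D.generator q c I a α b)) := by
    intro α b
    obtain ⟨y, hy⟩ := toBound_surjective (x α b)
    rw [← hy, map_mul, map_smul, Module.End.mul_apply, LinearMap.smul_apply]
    have h2 : Φ (q (D.arrow K a α b)) (1, 0) = (0, D.generator q c I a α b) := by
      change D.detectorAct q c I a (D.arrow K a α b) (1, 0) = _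
      rw [detectorAct_arrow, arrowAct_apply]
      simp
    rw [h2, Prod.smul_mk, smul_zero]
    exact D.detectorAct_apply_zero q c I a y _
  have h2 : ∑ α, ∑ b, x α b • (c a • D.generator q c I a α b) = 0 := by
    have := congrArg (fun z => (Φ z (1, 0)).2) h
    simp only [map_sum, LinearMap.sum_apply, Prod.snd_sum] at this
    rw [map_zero] at this
    refine Eq.trans (Finset.sum_congr rfl fun α _ => Finset.sum_congr rfl fun b _ => ?_) this
    exact (congrArg Prod.snd (h1 α b)).symm
  have h3 : ∀ β, ∑ b, x β b • (c a • D.generator q c I a β b) =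
      if D.src β = D.base a then D.toDetector q c I β (c a • x β) else 0 := by
    intro β
    split_ifs with hβ
    · have h4 : ∀ b, x β b • (c a • D.generator q c I a β b) =
          D.toDetector q c I β (Pi.single b (c a • x β b)) := by
        intro b
        rw [generator]
        by_cases hb : D.tgt β = D.base b
        · rw [if_pos ⟨hβ, hb⟩, ← LinearMap.map_smul_of_tower, ← map_smul, ← Pi.single_smul,
            ← Pi.single_smul, smul_comm, smul_eq_mul, hx]
        · rw [if_neg fun h => hb h.2, hx' _ _ hb]
          simp
      rw [Finset.sum_congr rfl fun b _ => h4 b, ← map_sum, Finset.univ_sum_single]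
      rfl
    · exact Finset.sum_eq_zero fun b _ => by
        rw [generator, if_neg fun h => hβ h.1, smul_zero, smul_zero]
  have h4 := congrArg (D.detectorProj q c I α) h2
  rw [Finset.sum_congr rfl fun β _ => h3 β, map_sum, Finset.sum_eq_single α,
    if_pos hα, detectorProj_toDetector_self, map_zero, Submodule.Quotient.mk_eq_zero] at h4
  · have h6 := Submodule.smul_mem _ (algebraMap K _ (c a)⁻¹) h4
    rwa [algebraMap_smul, smul_smul, inv_mul_cancel₀ (hc a), one_smul] at h6
  · intro β _ hβ
    split_ifs
    · exact D.detectorProj_toDetector_of_ne q c I hβ.symm _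
    · exact map_zero _
  · simp

end Bound

end QuiverCover

namespace QuiverCover

/-! ### Bound quiver algebras as split quadratic algebras -/

section Bound

variable {K : Type w} [Field K] {V : Type u} [Quiver.{v} V] {C : Type (max u v)} {B : Type*}
  (D : QuiverCover V C B) [Fintype V]
variable {c : V → K} {I : C → C → Prop} {R : Set (PathAlgebra K V)}

open Classical in
/-- The one-dimensional representation at the vertex `b`. -/
def augmentation (K : Type w) [Field K] (b : V) : PathAlgebra K V →ₐ[K] K :=
  PathAlgebra.lift K (fun a => if a = b then 1 else 0) (fun _ _ _ => 0) (by simp)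
    (fun a a' h => by
      by_cases h1 : a = b
      · rw [if_neg (c := a' = b) fun h2 => h (h1.trans h2.symm), mul_zero]
      · rw [if_neg h1, zero_mul])
    (by simp) (by simp)

theorem augmentation_idem_self (b : V) : augmentation K b (PathAlgebra.idem K b) = 1 := by
  rw [augmentation, PathAlgebra.lift_idem, if_pos rfl]

theorem augmentation_arrow (b : V) (a : V) (α : C) (a' : V) :
    augmentation K b (D.arrow K a α a') = 0 := by
  obtain ⟨e, rfl⟩ | h := D.arrow_cases K a α a'
  · rw [arrow_cls]
    exact PathAlgebra.lift_ofArrow _ _ _ _ (by simp) e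
  · rw [h, map_zero]

/-- The one-dimensional representation at `b` kills all arrows, hence every coordinate of a member
of `relSpan`, but sends the idempotent at `b` to 1. -/
theorem single_notMem_relSpan
    (hR : ∀ x ∈ R, ∃ a α β d, I α β ∧ x = D.relation c a α β d) (b : V) (α : C) (x : V → _)
    (hx : x ∈ D.relSpan (toBound R) c I α) : x b ≠ toBound R (PathAlgebra.idem K b) := by
  have h1 : ∀ y ∈ R, augmentation K b y = 0 := by
    intro y hy
    obtain ⟨a', α, β, d, -, rfl⟩ := hR y hy
    simp [relation, map_sum, augmentation_arrow]
  let ε := desc (augmentation K b) h1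
  have h2 : ε (x b) = 0 := by
    induction hx using Submodule.span_induction with
    | mem x h =>
      obtain ⟨β, d, -, rfl⟩ := h
      rw [map_smul]
      change c b • augmentation K b _ = 0
      rw [augmentation_arrow, smul_zero]
    | zero => exact map_zero _
    | add x y _ _ hx hy => rw [Pi.add_apply, map_add, hx, hy, add_zero]
    | smul r x _ hx => rw [Pi.smul_apply, smul_eq_mul, map_mul, hx, mul_zero]
  intro h
  rw [h] at h2
  exact one_ne_zero ((augmentation_idem_self b).symm.trans h2)

/-- A vanishing arrow would be a linear relation whose only coefficient is the idempotent at `b`,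
and that one is not in `relSpan`. -/
theorem toBound_arrow_ne_zero [Fintype C] (hc : ∀ a, c a ≠ 0)
    (hI : ∀ α β, I α β → D.tgt α = D.src β)
    (hR : ∀ x ∈ R, ∃ a α β d, I α β ∧ x = D.relation c a α β d) {a : V} {α : C} {b : V}
    (ha : D.src α = D.base a) (hb : D.tgt α = D.base b) : toBound R (D.arrow K a α b) ≠ 0 := by
  classical
  intro h
  have := D.mem_relSpan_of_sum_eq_zero hc hI hR a
    (Pi.single α (Pi.single b (toBound R (PathAlgebra.idem K b)))) ?_ ?_ ?_ α ha
  · refine D.single_notMem_relSpan hR b α _ this ?_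
    simp
  · intro β b'
    by_cases hβ : β = α
    · subst hβ
      by_cases hb' : b' = b
      · subst hb'
        simp only [Pi.single_eq_same]
        rw [← map_mul, PathAlgebra.idem_mul_idem_self]
      · simp [hb']
    · simp [hβ]
  · intro β b' hb'
    by_cases hβ : β = α
    · subst hβ
      have : b' ≠ b := by
        rintro rfl
        exact hb' hb
      simp [this]
    · simp [hβ]
  · rw [Finset.sum_eq_single α, Finset.sum_eq_single b, h, smul_zero, mul_zero]
    · intro b' _ hb'
      simp [hb']
    · simp
    · intro β _ hβ
      simp [hβ]
    · simp

theorem exists_eq_sum [Fintype C] (hc : ∀ a, c a ≠ 0) (x : BoundQuiverAlgebra K R) :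
    ∃ (k : V → K) (y : V → C → V → BoundQuiverAlgebra K R),
      x = ∑ a, k a • toBound R (PathAlgebra.idem K a) +
        ∑ a, ∑ α, ∑ b, y a α b * (c a • toBound R (D.arrow K a α b)) := by
  let W₁ : Submodule K (BoundQuiverAlgebra K R) :=
    Submodule.span K (Set.range fun a => toBound R (PathAlgebra.idem K a))
  let W₂ : Submodule (BoundQuiverAlgebra K R) (BoundQuiverAlgebra K R) :=
    Submodule.span _ (Set.range fun p : V × C × V => c p.1 • toBound R (D.arrow K p.1 p.2.1 p.2.2))
  have h2 : ∀ a α b, toBound R (D.arrow K a α b) ∈ W₂ := fun a α b => by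
    have := W₂.smul_mem (algebraMap K _ (c a)⁻¹) (Submodule.subset_span ⟨(a, α, b), rfl⟩)
    rwa [algebraMap_smul, smul_smul, inv_mul_cancel₀ (hc a), one_smul] at this
  have key : ∀ y : PathAlgebra K V, toBound R y ∈ W₁ ⊔ W₂.restrictScalars K := by
    intro y
    induction y using PathAlgebra.induction_on with
    | h0 => rw [map_zero]; exact Submodule.zero_mem _
    | hadd x y hx hy => rw [map_add]; exact Submodule.add_mem _ hx hy
    | hsmul k x hx => rw [map_smul]; exact Submodule.smul_mem _ _ hx
    | hidem b => exact Submodule.mem_sup_left (Submodule.subset_span ⟨b, rfl⟩)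
    | @harr a b e x hx =>
      refine Submodule.mem_sup_right ?_
      rw [map_mul]
      obtain ⟨x₁, h₁, x₂, h₂, hx⟩ := Submodule.mem_sup.1 hx
      rw [← hx, mul_add]
      refine Submodule.add_mem _ ?_ (W₂.smul_mem _ h₂)
      clear hx
      induction h₁ using Submodule.span_induction with
      | mem x h =>
        obtain ⟨a', rfl⟩ := h
        simp only [← map_mul]
        by_cases ha : a' = a
        · subst ha
          rw [PathAlgebra.ofArrow_mul_idem, ← D.arrow_cls K]
          exact h2 _ _ _
        · rw [← PathAlgebra.ofArrow_mul_idem, mul_assoc,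
            PathAlgebra.idem_mul_idem_of_ne (Ne.symm ha), mul_zero, map_zero]
          exact Submodule.zero_mem _
      | zero => rw [mul_zero]; exact Submodule.zero_mem _
      | add x y _ _ hx hy => rw [mul_add]; exact Submodule.add_mem _ hx hy
      | smul k x _ hx =>
        rw [mul_smul_comm]
        exact Submodule.smul_mem _ _ hx
  obtain ⟨y, rfl⟩ := toBound_surjective x
  obtain ⟨x₁, h₁, x₂, h₂, hx⟩ := Submodule.mem_sup.1 (key y)
  obtain ⟨k, hk⟩ := (Submodule.mem_span_range_iff_exists_fun K).1 h₁
  obtain ⟨z, hz⟩ := (Submodule.mem_span_range_iff_exists_fun _).1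
    ((Submodule.restrictScalars_mem _ _ _).1 h₂)
  refine ⟨k, fun a α b => z (a, α, b), ?_⟩
  rw [← hx, ← hk, ← hz, Fintype.sum_prod_type]
  simp only [Fintype.sum_prod_type, smul_eq_mul]

/-- If only one vertex lies over the middle of a related pair, the relation has a single term and
the product is zero. The head of the list is the last arrow traversed, so the chain runs from later
to earlier arrows. -/
theorem isChain_of_prod_ne_zero
    (hR : ∀ a α β d, I α β → D.relation c a α β d ∈ TwoSidedIdeal.span R)
    (hc : ∀ a, c a ≠ 0) (l : List (V × C × V))
    (hl : (l.map fun p => c p.1 • toBound R (D.arrow K p.1 p.2.1 p.2.2)).prod ≠ 0) :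
    (l.map fun p => p.2.1).IsChain fun β α => D.tgt α = D.src β ∧
      (I α β → ∃ b b' : V, b ≠ b' ∧ D.base b = D.tgt α ∧ D.base b' = D.tgt α) := by
  induction l with
  | nil => exact List.isChain_nil
  | cons p l ih =>
    cases l with
    | nil => exact List.isChain_singleton _
    | cons p' l =>
      rw [List.map_cons, List.prod_cons] at hl
      have h1 := ih (right_ne_zero_of_mul hl)
      rw [List.map_cons, List.prod_cons, ← mul_assoc] at hl
      have h2 := left_ne_zero_of_mul hl
      rw [List.map_cons, List.map_cons, List.isChain_cons_cons]
      refine ⟨?_, h1⟩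
      obtain ⟨b, β, d⟩ := p
      obtain ⟨a, α, b'⟩ := p'
      simp only at h2 ⊢
      rw [smul_mul_smul_comm, ← map_mul] at h2
      have h3 : D.arrow K b β d * D.arrow K a α b' ≠ 0 := by
        intro h
        rw [h, map_zero, smul_zero] at h2
        exact h2 rfl
      have hβ : D.src β = D.base b ∧ D.tgt β = D.base d := by
        by_contra h
        rw [D.arrow_eq_zero K h, zero_mul] at h3
        exact h3 rfl
      have hα : D.src α = D.base a ∧ D.tgt α = D.base b' := by
        by_contra h
        rw [D.arrow_eq_zero K h, mul_zero] at h3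
        exact h3 rfl
      have hb : b' = b := by
        by_contra hb
        rw [← D.arrow_mul_idem K b β d, mul_assoc, ← D.idem_mul_arrow K a α b',
          ← mul_assoc (PathAlgebra.idem K b), PathAlgebra.idem_mul_idem_of_ne (Ne.symm hb),
          zero_mul, mul_zero] at h3
        exact h3 rfl
      subst hb
      refine ⟨hα.2.trans hβ.1.symm, fun h => ?_⟩
      by_contra! hcon
      have h4 : D.relation c a α β d = c b' • (D.arrow K b' β d * D.arrow K a α b') := by
        refine Finset.sum_eq_single b' (fun b _ hb => ?_) (by simp)
        rw [D.arrow_eq_zero K (a := a) (α := α) (b := b), mul_zero, smul_zero]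
        rintro ⟨-, h⟩
        exact hcon b b' hb h.symm hα.2.symm
      have h5 := toBound_eq_zero (hR a α β d h)
      rw [h4, map_smul] at h5
      have h6 : toBound R (D.arrow K b' β d * D.arrow K a α b') = 0 := by
        have := congrArg ((c b')⁻¹ • ·) h5
        simpa only [smul_smul, inv_mul_cancel₀ (hc b'), one_smul, smul_zero] using this
      rw [h6, smul_zero] at h2
      exact h2 rfl

/-- The bound quiver algebra of a quiver over a base is a split quadratic algebra. -/
def splitAlgebra [Fintype C] (hc : ∀ a, c a ≠ 0)
    (hI : ∀ α β, I α β → D.tgt α = D.src β)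
    (hR : ∀ x ∈ R, ∃ a α β d, I α β ∧ x = D.relation c a α β d)
    (hR' : ∀ a α β d, I α β → D.relation c a α β d ∈ TwoSidedIdeal.span R)
    (hnil : ∃ n : ℕ, ∀ l : List C, l.length = n → ¬ l.IsChain fun β α => D.tgt α = D.src β ∧
      (I α β → ∃ b b' : V, b ≠ b' ∧ D.base b = D.tgt α ∧ D.base b' = D.tgt α)) :
    SplitAlgebra.{u, v, w} K (BoundQuiverAlgebra K R) V C where
  e a := toBound R (PathAlgebra.idem K a)
  -- Scaling by the coefficient of the starting vertex turns the weighted relations into unweighted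
  -- sums, up to the common factor `c a`.
  arr a α b := c a • toBound R (D.arrow K a α b)
  Src α a := D.src α = D.base a
  Tgt α a := D.tgt α = D.base a
  rel := I
  exists_src α := by
    obtain ⟨a, ha⟩ := D.base_surjective (D.src α)
    exact ⟨a, ha.symm⟩
  exists_tgt α := by
    obtain ⟨a, ha⟩ := D.base_surjective (D.tgt α)
    exact ⟨a, ha.symm⟩
  src_iff_tgt h b := by rw [hI _ _ h]
  e_mul_self a := by rw [← map_mul, PathAlgebra.idem_mul_idem_self]
  e_mul_of_ne h := by rw [← map_mul, PathAlgebra.idem_mul_idem_of_ne h, map_zero]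
  sum_e := by
    rw [← map_sum, ← map_one (toBound R), PathAlgebra.one_def]
    congr!
  e_mul_arr a α b := by rw [mul_smul_comm, ← map_mul, idem_mul_arrow]
  arr_mul_e a α b := by rw [smul_mul_assoc, ← map_mul, arrow_mul_idem]
  arr_ne_zero_iff a α b := by
    constructor
    · intro h
      by_contra h'
      rw [D.arrow_eq_zero K h', map_zero, smul_zero] at h
      exact h rfl
    · rintro ⟨ha, hb⟩ h
      have h6 : toBound R (D.arrow K a α b) = 0 := by
        have := congrArg ((c a)⁻¹ • ·) h
        simpa only [smul_smul, inv_mul_cancel₀ (hc a), one_smul, smul_zero] using this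
      exact D.toBound_arrow_ne_zero hc hI hR ha hb h6
  sum_arr_mul_arr {α β} h a d := by
    have h1 := congrArg (c a • ·) (toBound_eq_zero (hR' a α β d h))
    simp only [relation, map_sum, map_smul, map_mul, Finset.smul_sum, smul_zero] at h1
    rw [← h1]
    refine Finset.sum_congr rfl fun b _ => ?_
    rw [smul_mul_smul_comm, smul_smul, mul_comm]
  exists_eq_sum := D.exists_eq_sum hc
  exists_prod_eq_zero := by
    obtain ⟨n, hn⟩ := hnil
    refine ⟨n, fun l hl => ?_⟩
    by_contra h
    exact hn _ (by rw [List.length_map, hl]) (D.isChain_of_prod_ne_zero hR' hc l h)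
  mem_span_of_sum_eq_zero a x hx hx' h α hα := D.mem_relSpan_of_sum_eq_zero hc hI hR a x hx hx' h α hα

end Bound

theorem globalDimension_lt_top_iff {K : Type w} [Field K] {V : Type u} [Quiver.{v} V]
    {C : Type (max u v)} {B : Type*} (D : QuiverCover V C B) [Finite V] [Finite C]
    {c : V → K} {I : C → C → Prop} {R : Set (PathAlgebra K V)} (hc : ∀ a, c a ≠ 0)
    (hI : ∀ α β, I α β → D.tgt α = D.src β)
    (hR : letI := Fintype.ofFinite V; ∀ x ∈ R, ∃ a α β d, I α β ∧ x = D.relation c a α β d)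
    (hR' : letI := Fintype.ofFinite V;
      ∀ a α β d, I α β → D.relation c a α β d ∈ TwoSidedIdeal.span R)
    (hnil : ∃ n : ℕ, ∀ l : List C, l.length = n → ¬ l.IsChain fun β α => D.tgt α = D.src β ∧
      (I α β → ∃ b b' : V, b ≠ b' ∧ D.base b = D.tgt α ∧ D.base b' = D.tgt α)) :
    globalDimension (BoundQuiverAlgebra K R) < ⊤ ↔ ∀ α, Acc (fun β α => I α β) α := by
  let := Fintype.ofFinite V
  let := Fintype.ofFinite C
  exact (D.splitAlgebra hc hI hR hR' hnil).globalDimension_lt_top_iff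

end QuiverCover

/-! ### Paths avoiding relations -/

section Free

variable {Q : Type u} [Quiver.{v} Q] (I : QuadraticRelations Q)

/-- The path contains no two consecutive arrows in `I`. -/
def AvoidsRelations {a : Q} : ∀ {b : Q}, Quiver.Path a b → Prop
  | _, .nil => True
  | _, .cons .nil _ => True
  | _, .cons (.cons p e) f => AvoidsRelations (.cons p e) ∧ ¬ I e f

/-- The path contains two consecutive arrows in `I`. -/
def MeetsRelations {a b : Q} (p : Quiver.Path a b) : Prop :=
  ∃ (x y z : Q) (r : Quiver.Path a x) (e : x ⟶ y) (f : y ⟶ z) (s : Quiver.Path z b),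
    I e f ∧ p = ((r.cons e).cons f).comp s

variable {I}

theorem AvoidsRelations.of_cons {a b c : Q} {p : Quiver.Path a b} {e : b ⟶ c}
    (h : AvoidsRelations I (p.cons e)) : AvoidsRelations I p := by
  cases p with
  | nil => trivial
  | cons p f => exact h.1

theorem AvoidsRelations.not_meetsRelations {a b : Q} {p : Quiver.Path a b}
    (h : AvoidsRelations I p) : ¬ MeetsRelations I p := by
  rintro ⟨x, y, z, r, e, f, s, hef, rfl⟩
  induction s with
  | nil => exact h.2 hef
  | cons s g ih => exact ih h.of_cons

theorem MeetsRelations.comp_right {a b c : Q} {p : Quiver.Path a b} (h : MeetsRelations I p)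
    (q : Quiver.Path b c) : MeetsRelations I (p.comp q) := by
  obtain ⟨x, y, z, r, e, f, s, hef, rfl⟩ := h
  exact ⟨x, y, z, r, e, f, s.comp q, hef, Quiver.Path.comp_assoc _ _ _⟩

theorem MeetsRelations.comp_left {a b c : Q} {p : Quiver.Path b c} (h : MeetsRelations I p)
    (q : Quiver.Path a b) : MeetsRelations I (q.comp p) := by
  obtain ⟨x, y, z, r, e, f, s, hef, rfl⟩ := h
  exact ⟨x, y, z, q.comp r, e, f, s, hef, by simp [← Quiver.Path.comp_assoc]⟩

variable (K : Type w) [Field K] (I)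

/-- The span of the paths containing two consecutive arrows in `I`. -/
def meetsSpan : Submodule K (PathAlgebra K Q) :=
  Submodule.span K (PathAlgebra.ofPath K '' {p : AnyPath Q | MeetsRelations I p.2.2})

theorem meetsRelations_of_mem_meetsSpan {p : AnyPath Q}
    (h : PathAlgebra.ofPath K p ∈ meetsSpan I K) : MeetsRelations I p.2.2 := by
  have h1 : (Finsupp.single p (1 : K)) ∈ Finsupp.supported K K
      {p : AnyPath Q | MeetsRelations I p.2.2} := by
    rw [Finsupp.supported_eq_span_single]
    exact h
  rw [Finsupp.mem_supported] at h1
  exact h1 (by simp)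

variable {I K}

theorem mulPath_mem_meetsSpan {p q : AnyPath Q}
    (h : MeetsRelations I p.2.2 ∨ MeetsRelations I q.2.2) :
    PathAlgebra.mulPath K p q ∈ meetsSpan I K := by
  obtain ⟨b, c, p⟩ := p
  obtain ⟨a, b', q⟩ := q
  rw [PathAlgebra.mulPath]
  split_ifs with hb
  · obtain rfl : b' = b := hb
    refine Submodule.subset_span ⟨_, ?_, rfl⟩
    rcases h with h | h
    · exact h.comp_left q
    · exact h.comp_right p
  · exact Submodule.zero_mem _

theorem span_range_ofPath :
    Submodule.span K (Set.range (PathAlgebra.ofPath K)) = (⊤ : Submodule K (PathAlgebra K Q)) :=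
  (Finsupp.basisSingleOne (R := K) (ι := AnyPath Q)).span_eq ▸ by
    congr 2

theorem mul_mem_meetsSpan_left (x : PathAlgebra K Q) {y : PathAlgebra K Q}
    (hy : y ∈ meetsSpan I K) : x * y ∈ meetsSpan I K := by
  rw [PathAlgebra.mul_def]
  induction hy using Submodule.span_induction with
  | mem y h =>
    obtain ⟨q, hq, rfl⟩ := h
    have key : LinearMap.range ((PathAlgebra.mulHom K).flip (PathAlgebra.ofPath K q)) ≤
        meetsSpan I K := by
      rw [← Submodule.map_top, ← span_range_ofPath, Submodule.map_span, Submodule.span_le]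
      rintro _ ⟨_, ⟨p, rfl⟩, rfl⟩
      rw [LinearMap.flip_apply, PathAlgebra.mulHom_ofPath]
      exact mulPath_mem_meetsSpan (Or.inr hq)
    exact key ⟨x, rfl⟩
  | zero => rw [map_zero]; exact Submodule.zero_mem _
  | add y z _ _ hy hz => rw [map_add]; exact Submodule.add_mem _ hy hz
  | smul k y _ hy => rw [map_smul]; exact Submodule.smul_mem _ _ hy

theorem mul_mem_meetsSpan_right {x : PathAlgebra K Q} (y : PathAlgebra K Q)
    (hx : x ∈ meetsSpan I K) : x * y ∈ meetsSpan I K := by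
  rw [PathAlgebra.mul_def]
  induction hx using Submodule.span_induction with
  | mem x h =>
    obtain ⟨p, hp, rfl⟩ := h
    have key : LinearMap.range (PathAlgebra.mulHom K (PathAlgebra.ofPath K p)) ≤
        meetsSpan I K := by
      rw [← Submodule.map_top, ← span_range_ofPath, Submodule.map_span, Submodule.span_le]
      rintro _ ⟨_, ⟨q, rfl⟩, rfl⟩
      rw [PathAlgebra.mulHom_ofPath]
      exact mulPath_mem_meetsSpan (Or.inl hp)
    exact key ⟨y, rfl⟩
  | zero => rw [map_zero]; exact Submodule.zero_mem _
  | add y z _ _ hy hz => rw [map_add]; exact Submodule.add_mem _ hy hz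
  | smul k y _ hy => rw [map_smul]; exact Submodule.smul_mem _ _ hy

/-- If the ideal generated by `I` is admissible, then the paths avoiding `I` have bounded
length. -/
theorem exists_length_lt_of_avoidsRelations [Finite Q]
    (h : PathAlgebra.IsAdmissible (TwoSidedIdeal.span (zeroRelations K I))) :
    ∃ m : ℕ, ∀ (a b : Q) (p : Quiver.Path a b), AvoidsRelations I p → p.length < m := by
  obtain ⟨⟨m, -, hm⟩, -⟩ := h
  refine ⟨m, fun a b p hp => ?_⟩
  by_contra! hlen
  have h1 := hm (Submodule.subset_span ⟨(⟨a, b, p⟩ : AnyPath Q), hlen, rfl⟩)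
  let Z : TwoSidedIdeal (PathAlgebra K Q) := TwoSidedIdeal.mk' (meetsSpan I K)
    (Submodule.zero_mem _) (Submodule.add_mem _) (Submodule.neg_mem _)
    (fun hy => mul_mem_meetsSpan_left _ hy) (fun hx => mul_mem_meetsSpan_right _ hx)
  have h2 : TwoSidedIdeal.span (zeroRelations K I) ≤ Z := by
    rw [TwoSidedIdeal.span_le]
    rintro _ ⟨α, β, hαβ⟩
    refine (TwoSidedIdeal.mem_mk' ..).2 (Submodule.subset_span ⟨_, ?_,
      (PathAlgebra.ofArrow_mul_ofPath _ β).symm⟩)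
    exact ⟨_, _, _, .nil, α, β, .nil, hαβ, rfl⟩
  have h3 := (TwoSidedIdeal.mem_mk' ..).1 (h2 h1)
  exact hp.not_meetsRelations (meetsRelations_of_mem_meetsSpan I K h3)

end Free

/-! ### Arrows and consecutive arrows in a relation -/

section Arrows

/-- The arrows of a quiver. -/
abbrev Arrows (Q : Type u) [Quiver.{v} Q] : Type (max u v) := Σ a b : Q, a ⟶ b

variable {Q : Type u} [Quiver.{v} Q]

/-- The arrow `y` can be composed with the arrow `x`, and the composition `yx` is in `I`. -/
def Follows (I : QuadraticRelations Q) (x y : Arrows Q) : Prop :=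
  ∃ h : y.1 = x.2.1, I x.2.2 (y.2.2.cast h rfl)

theorem follows_iff {I : QuadraticRelations Q} {a b c : Q} {α : a ⟶ b} {β : b ⟶ c} :
    Follows I ⟨a, b, α⟩ ⟨b, c, β⟩ ↔ I α β :=
  ⟨fun ⟨_, h⟩ => h, fun h => ⟨rfl, h⟩⟩

/-- No infinite sequence of arrows has all consecutive compositions in `I`. -/
def RelationsTerminate (I : QuadraticRelations Q) : Prop :=
  ∀ α : Arrows Q, Acc (fun β α => Follows I α β) α

theorem finite_arrows [Finite Q] (h : ∀ a : Q, ENat.card (Σ b : Q, a ⟶ b) ≤ 2) :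
    Finite (Arrows Q) := by
  have : ∀ a : Q, Finite (Σ b : Q, a ⟶ b) := fun a =>
    ENat.card_lt_top.1 ((h a).trans_lt (by decide))
  infer_instance

theorem finite_hom [Finite (Arrows Q)] (a b : Q) : Finite (a ⟶ b) :=
  Finite.of_injective (fun e : a ⟶ b => (⟨a, b, e⟩ : Arrows Q)) fun e f h => by
    simpa using h

end Arrows

/-! ### Bounding chains by inserting special loops -/

section SpecialChains

variable {Q : Type u} [Quiver.{v} Q] {I : QuadraticRelations Q} {Sp : Set Q}

theorem not_spRelations_old_loop {a b : Q} (α : a ⟶ b) (hb : b ∈ Sp) :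
    ¬ SpRelations I Sp (SpArrow.old α) (SpArrow.loop b hb) := by
  rintro ⟨⟩

theorem not_spRelations_loop_old {a b : Q} (α : a ⟶ b) (ha : a ∈ Sp) :
    ¬ SpRelations I Sp (SpArrow.loop a ha) (SpArrow.old α) := by
  rintro ⟨⟩

theorem spRelations_old_old_iff {a b c : Q} {α : a ⟶ b} {β : b ⟶ c} :
    SpRelations I Sp (SpArrow.old α) (SpArrow.old β) ↔ I α β := by
  constructor
  · rintro ⟨_, _, h⟩
    exact h
  · exact SpRelations.old α β

/-- Between two arrows composing to an element of `I` the special loop is inserted; neither new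
composition is in `I^sp`. The path `p` stops before the arrow `β`, so that `β` remains the last
arrow for the next step. -/
theorem exists_path_of_isChain (l : List (Arrows Q)) (β : Arrows Q)
    (hl : (β :: l).IsChain fun β α => α.2.1 = β.1 ∧ (Follows I α β → α.2.1 ∈ Sp)) :
    ∃ (a : Qsp Sp) (p : Quiver.Path a (⟨β.1⟩ : Qsp Sp)), l.length ≤ p.length ∧
      AvoidsRelations (SpRelations I Sp)
        (p.cons (show (⟨β.1⟩ : Qsp Sp) ⟶ ⟨β.2.1⟩ from SpArrow.old β.2.2)) := by
  induction l generalizing β with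
  | nil => exact ⟨_, .nil, le_rfl, trivial⟩
  | cons α l ih =>
    rw [List.isChain_cons_cons] at hl
    obtain ⟨⟨hcomp, hrel⟩, hl⟩ := hl
    obtain ⟨a, p, hlen, hp⟩ := ih α hl
    obtain ⟨x, y, α⟩ := α
    obtain ⟨y', z, β⟩ := β
    obtain rfl : y = y' := hcomp
    rw [follows_iff] at hrel
    by_cases h : I α β
    · refine ⟨a, (p.cons (show (⟨x⟩ : Qsp Sp) ⟶ ⟨y⟩ from SpArrow.old α)).cons
        (show (⟨y⟩ : Qsp Sp) ⟶ ⟨y⟩ from SpArrow.loop y (hrel h)), ?_, ⟨hp, not_spRelations_old_loop α (hrel h)⟩,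
        not_spRelations_loop_old β (hrel h)⟩
      simp only [List.length_cons, Quiver.Path.length_cons]
      lia
    · refine ⟨a, p.cons (show (⟨x⟩ : Qsp Sp) ⟶ ⟨y⟩ from SpArrow.old α), ?_, hp,
        fun h' => h (spRelations_old_old_iff.1 h')⟩
      simp only [List.length_cons, Quiver.Path.length_cons]
      lia

theorem exists_length_lt_of_isChain {K : Type w} [Field K] [Finite Q]
    (h : IsGentle K (SpRelations I Sp)) : ∃ m : ℕ, ∀ l : List (Arrows Q),
      (l.IsChain fun β α => α.2.1 = β.1 ∧ (Follows I α β → α.2.1 ∈ Sp)) → l.length < m := by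
  obtain ⟨m, hm⟩ := exists_length_lt_of_avoidsRelations h.admissible
  refine ⟨m + 1, fun l hl => ?_⟩
  cases l with
  | nil => simp
  | cons β l =>
    obtain ⟨a, p, hlen, hp⟩ := exists_path_of_isChain l β hl
    have := hm _ _ _ hp
    simp only [Quiver.Path.length_cons, List.length_cons] at this ⊢
    lia

end SpecialChains

/-! ### Quivers with zero relations -/

section Monomial

variable {Q : Type u} [Quiver.{v} Q]

/-- A quiver, over its own vertices. -/
def selfCover (Q : Type u) [Quiver.{v} Q] : QuiverCover Q (Arrows Q) Q where
  base := id
  src := fun α => α.1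
  tgt := fun α => α.2.1
  cls {a b} e := ⟨a, b, e⟩
  base_surjective := Function.surjective_id
  cls_injective a b e f h := by simpa using h
  src_cls _ := rfl
  tgt_cls _ := rfl
  exists_cls {a b α} ha hb := by
    obtain ⟨x, y, e⟩ := α
    obtain rfl : x = a := ha
    obtain rfl : y = b := hb
    exact ⟨e, rfl⟩

theorem selfCover_relation (K : Type w) [Field K] [Fintype Q] (a d : Q) {x y z : Q} (α : x ⟶ y)
    (β : y ⟶ z) : (selfCover Q).relation (fun _ => (1 : K)) a ⟨x, y, α⟩ ⟨y, z, β⟩ d =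
      (selfCover Q).arrow K y ⟨y, z, β⟩ d * (selfCover Q).arrow K a ⟨x, y, α⟩ y := by
  rw [QuiverCover.relation, Finset.sum_eq_single y, one_smul]
  · intro b _ hb
    rw [(selfCover Q).arrow_eq_zero K (a := a) (α := ⟨x, y, α⟩) (b := b)
      (fun h => hb h.2.symm), mul_zero, smul_zero]
  · simp

theorem selfCover_arrow (K : Type w) [Field K] {x y : Q} (α : x ⟶ y) :
    (selfCover Q).arrow K x ⟨x, y, α⟩ y = PathAlgebra.ofArrow K α :=
  (selfCover Q).arrow_cls K α

theorem globalDimension_zeroRelations_lt_top_iff (K : Type w) [Field K] [Finite Q]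
    [Finite (Arrows Q)] (I : QuadraticRelations Q)
    (hnil : ∃ m : ℕ, ∀ l : List (Arrows Q),
      (l.IsChain fun β α => α.2.1 = β.1 ∧ ¬ Follows I α β) → l.length < m) :
    globalDimension (BoundQuiverAlgebra K (zeroRelations K I)) < ⊤ ↔ RelationsTerminate I := by
  refine (selfCover Q).globalDimension_lt_top_iff (c := fun _ => 1) (I := Follows I)
    (fun _ => one_ne_zero) (fun α β h => h.1.symm) ?_ ?_ ?_
  · rintro _ @⟨x, y, z, α, β, h⟩
    refine ⟨x, ⟨x, y, α⟩, ⟨y, z, β⟩, z, follows_iff.2 h, ?_⟩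
    rw [selfCover_relation, selfCover_arrow, selfCover_arrow]
  · rintro a ⟨x, y, α⟩ ⟨y', z, β⟩ d h
    obtain rfl : y' = y := h.1
    rw [follows_iff] at h
    rw [selfCover_relation]
    by_cases ha : x = a
    · by_cases hd : z = d
      · subst ha hd
        rw [selfCover_arrow, selfCover_arrow]
        exact TwoSidedIdeal.subset_span ⟨α, β, h⟩
      · rw [(selfCover Q).arrow_eq_zero K (α := ⟨y', z, β⟩) (b := d) (fun h => hd h.2), zero_mul]
        exact TwoSidedIdeal.zero_mem _
    · rw [(selfCover Q).arrow_eq_zero K (a := a) (α := ⟨x, y', α⟩) (fun h => ha h.1), mul_zero]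
      exact TwoSidedIdeal.zero_mem _
  · obtain ⟨m, hm⟩ := hnil
    -- The base is `Q` itself, so no two distinct vertices lie over one point and no related pair
    -- can occur in the chain.
    refine ⟨m, fun l hl hchain => (hm l (hchain.imp ?_)).ne hl⟩
    rintro β α ⟨h1, h2⟩
    refine ⟨h1, fun h => ?_⟩
    obtain ⟨b, b', hne, hb, hb'⟩ := h2 h
    exact hne (hb.trans hb'.symm)

end Monomial

/-! ### The quiver `Q^sg` over `Q` -/

section SkewedGentlePair

variable {Q : Type u} {Sp : Set Q}

theorem Qsg.base_surjective : Function.Surjective (Qsg.base (Sp := Sp)) := by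
  intro i
  by_cases hi : i ∈ Sp
  · exact ⟨.double i hi true, rfl⟩
  · exact ⟨.single i hi, rfl⟩

/-- The sign of a vertex of `Q^sg`. -/
def sgSign (K : Type w) [Field K] : Qsg Sp → K
  | .single _ _ => 1
  | .double _ _ true => 1
  | .double _ _ false => -1

theorem sgSign_ne_zero (K : Type w) [Field K] (a : Qsg Sp) : sgSign K a ≠ 0 := by
  rcases a with _ | ⟨_, _, _ | _⟩ <;> simp [sgSign]

variable [Quiver.{v} Q]

/-- The quiver `Q^sg`, over the vertices of `Q`. -/
def sgCover (Sp : Set Q) : QuiverCover (Qsg Sp) (Arrows Q) Q where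
  base := Qsg.base
  src := fun α => α.1
  tgt := fun α => α.2.1
  cls {a b} e := ⟨a.base, b.base, SgArrow.arrow e⟩
  base_surjective := Qsg.base_surjective
  cls_injective a b e f h := by
    obtain ⟨e⟩ := e
    obtain ⟨f⟩ := f
    obtain rfl : e = f := by simpa using h
    rfl
  src_cls _ := rfl
  tgt_cls _ := rfl
  exists_cls {a b α} ha hb := by
    obtain ⟨x, y, e⟩ := α
    obtain rfl : x = a.base := ha
    obtain rfl : y = b.base := hb
    exact ⟨⟨e⟩, rfl⟩

theorem sgCover_arrow (K : Type w) [Field K] (a b : Qsg Sp) (α : a.base ⟶ b.base) :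
    (sgCover Sp).arrow K a ⟨a.base, b.base, α⟩ b = sgArrow K a b α :=
  (sgCover Sp).arrow_cls K (show a ⟶ b from ⟨α⟩)

variable (K : Type w) [Field K] [Fintype (Qsg Sp)]

theorem sgCover_relation_ordinary (a d : Qsg Sp) {j : Q} (hj : j ∉ Sp) (α : a.base ⟶ j)
    (β : j ⟶ d.base) : (sgCover Sp).relation (sgSign K) a ⟨a.base, j, α⟩ ⟨j, d.base, β⟩ d =
      sgArrow K (Qsg.ordinary j hj) d β * sgArrow K a (Qsg.ordinary j hj) α := by
  rw [QuiverCover.relation, Finset.sum_eq_single (Qsg.ordinary j hj)]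
  · have h₁ : (sgCover Sp).arrow K (Qsg.ordinary j hj) ⟨j, d.base, β⟩ d =
        sgArrow K (Qsg.ordinary j hj) d β := sgCover_arrow K (Qsg.ordinary j hj) d β
    have h₂ : (sgCover Sp).arrow K a ⟨a.base, j, α⟩ (Qsg.ordinary j hj) =
        sgArrow K a (Qsg.ordinary j hj) α := sgCover_arrow K a (Qsg.ordinary j hj) α
    rw [h₁, h₂]
    exact one_smul K _
  · intro b _ hb
    rw [(sgCover Sp).arrow_eq_zero K (a := a) (b := b), mul_zero, smul_zero]
    rintro ⟨-, h⟩
    obtain rfl : j = b.base := h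
    obtain ⟨i, hi⟩ | ⟨i, hi, δ⟩ := b
    · exact hb rfl
    · exact hj hi
  · simp

theorem sgCover_relation_special (a d : Qsg Sp) {j : Q} (hj : j ∈ Sp) (α : a.base ⟶ j)
    (β : j ⟶ d.base) : (sgCover Sp).relation (sgSign K) a ⟨a.base, j, α⟩ ⟨j, d.base, β⟩ d =
      sgArrow K (Qsg.plus j hj) d β * sgArrow K a (Qsg.plus j hj) α -
        sgArrow K (Qsg.minus j hj) d β * sgArrow K a (Qsg.minus j hj) α := by
  classical
  have hne : Qsg.plus j hj ≠ Qsg.minus j hj := fun h => by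
    injection h with _ h
    exact Bool.noConfusion h
  have h₁ : ∀ δ, (sgCover Sp).arrow K (SplitVertex.double j hj δ) ⟨j, d.base, β⟩ d =
      sgArrow K (SplitVertex.double j hj δ) d β := fun δ =>
    sgCover_arrow K (SplitVertex.double j hj δ) d β
  have h₂ : ∀ δ, (sgCover Sp).arrow K a ⟨a.base, j, α⟩ (SplitVertex.double j hj δ) =
      sgArrow K a (SplitVertex.double j hj δ) α := fun δ =>
    sgCover_arrow K a (SplitVertex.double j hj δ) α
  rw [QuiverCover.relation, ← Finset.sum_subset (Finset.subset_univ {Qsg.plus j hj, Qsg.minus j hj}),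
    Finset.sum_pair hne, sub_eq_add_neg]
  · refine congrArg₂ _ ((one_smul K _).trans ?_) ((neg_one_smul K _).trans (congrArg _ ?_))
    · exact congrArg₂ _ (h₁ true) (h₂ true)
    · exact congrArg₂ _ (h₁ false) (h₂ false)
  · intro b _ hb
    rw [(sgCover Sp).arrow_eq_zero K (a := a) (b := b), mul_zero, smul_zero]
    rintro ⟨-, h⟩
    obtain rfl : j = b.base := h
    refine hb ?_
    obtain ⟨i, hi⟩ | ⟨i, hi, _ | _⟩ := b
    · exact absurd hj hi
    · exact Finset.mem_insert_of_mem (Finset.mem_singleton_self _)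
    · exact Finset.mem_insert_self _ _

end SkewedGentlePair

theorem globalDimension_sgRelations_lt_top_iff {Q : Type u} [Quiver.{v} Q] {Sp : Set Q}
    (K : Type w) [Field K] [Finite Q] [Finite (Arrows Q)] (I : QuadraticRelations Q)
    (hnil : ∃ m : ℕ, ∀ l : List (Arrows Q),
      (l.IsChain fun β α => α.2.1 = β.1 ∧ (Follows I α β → α.2.1 ∈ Sp)) → l.length < m) :
    globalDimension (BoundQuiverAlgebra K (sgRelations K I Sp)) < ⊤ ↔ RelationsTerminate I := by
  let := Fintype.ofFinite (Qsg Sp)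
  refine (sgCover Sp).globalDimension_lt_top_iff (c := sgSign K) (I := Follows I)
    (sgSign_ne_zero K) (fun α β h => h.1.symm) ?_ ?_ ?_
  · rintro _ (⟨a, d, j, hj, α, β, h⟩ | ⟨a, d, j, hj, α, β, h⟩)
    · exact ⟨a, ⟨_, _, α⟩, ⟨_, _, β⟩, d, follows_iff.2 h,
        (sgCover_relation_ordinary K a d hj α β).symm⟩
    · exact ⟨a, ⟨_, _, α⟩, ⟨_, _, β⟩, d, follows_iff.2 h,
        (sgCover_relation_special K a d hj α β).symm⟩
  · rintro a ⟨x, j, α⟩ ⟨j', z, β⟩ d h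
    obtain rfl : j' = j := h.1
    rw [follows_iff] at h
    by_cases ha : x = a.base
    · by_cases hd : z = d.base
      · subst ha hd
        by_cases hj : j' ∈ Sp
        · rw [sgCover_relation_special K a d hj]
          exact TwoSidedIdeal.subset_span (.special a d _ hj α β h)
        · rw [sgCover_relation_ordinary K a d hj]
          exact TwoSidedIdeal.subset_span (.ordinary a d _ hj α β h)
      · have : ∀ b, (sgCover Sp).arrow K b ⟨j', z, β⟩ d = 0 := fun b =>
          (sgCover Sp).arrow_eq_zero K fun h => hd h.2
        simp only [QuiverCover.relation, this, zero_mul, smul_zero, Finset.sum_const_zero]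
        exact TwoSidedIdeal.zero_mem _
    · have : ∀ b, (sgCover Sp).arrow K a ⟨x, j', α⟩ b = 0 := fun b =>
        (sgCover Sp).arrow_eq_zero K fun h => ha h.1
      simp only [QuiverCover.relation, this, mul_zero, smul_zero, Finset.sum_const_zero]
      exact TwoSidedIdeal.zero_mem _
  · obtain ⟨m, hm⟩ := hnil
    -- Two distinct vertices of `Q^sg` over the same `j` exist only if `j` is special.
    refine ⟨m, fun l hl hchain => (hm l (hchain.imp ?_)).ne hl⟩
    rintro β ⟨x, j, α⟩ ⟨h1, h2⟩
    refine ⟨h1, fun h => ?_⟩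
    obtain ⟨b, b', hne, hb, hb'⟩ := h2 h
    by_contra hj
    obtain ⟨i, hi⟩ | ⟨i, hi, δ⟩ := b
    · obtain ⟨i', hi'⟩ | ⟨i', hi', δ'⟩ := b'
      · obtain rfl : i = j := hb
        obtain rfl : i' = i := hb'
        exact hne rfl
      · obtain rfl : i' = j := hb'
        exact hj hi'
    · obtain rfl : i = j := hb
      exact hj hi

/-! ### Comparison of `Q^g` with `Q` -/

section AssociatedGentlePair

variable {Q : Type u} {Sp : Set Q}

theorem Qg.base_withSign (i : Q) (δ : Bool) : (Qg.withSign Sp i δ).base = i := by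
  rw [Qg.withSign, SplitVertex.withSign]
  split_ifs <;> rfl

theorem Qg.withSign_eq_of_mem {i : Q} (hi : i ∈ Sp) (δ ε : Bool) :
    Qg.withSign Sp i δ = Qg.withSign Sp i ε := by
  rw [Qg.withSign, Qg.withSign, SplitVertex.withSign, SplitVertex.withSign,
    dif_neg (fun h => h hi), dif_neg (fun h => h hi)]

theorem Qg.withSign_injective {i : Q} (hi : i ∉ Sp) {δ ε : Bool}
    (h : Qg.withSign Sp i δ = Qg.withSign Sp i ε) : δ = ε := by
  have hdef : ∀ δ, Qg.withSign Sp i δ = SplitVertex.double i hi δ := fun δ => dif_pos hi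
  rw [hdef, hdef] at h
  injection h

variable [Quiver.{v} Q] {I : QuadraticRelations Q}

/-- The arrow of `Q` from which an arrow of `Q^g` comes. -/
def gProj (x : Arrows (Qg Sp)) : Arrows Q := ⟨x.1.base, x.2.1.base, GArrow.arrow x.2.2⟩

theorem gProj_surjective : Function.Surjective (gProj (Sp := Sp)) := by
  rintro ⟨a, b, α⟩
  have : ∀ i : Q, ∃ i' : Qg Sp, i'.base = i ∧ Qg.withSign Sp i true = i' := fun i =>
    ⟨_, Qg.base_withSign i true, rfl⟩
  obtain ⟨a, rfl, ha⟩ := this a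
  obtain ⟨b, rfl, hb⟩ := this b
  exact ⟨⟨a, b, ⟨α, true, ha, hb⟩⟩, rfl⟩

theorem Follows.gProj {x y : Arrows (Qg Sp)} (h : Follows (GRelations I Sp) x y) :
    Follows I (gProj x) (gProj y) := by
  obtain ⟨a, b, α⟩ := x
  obtain ⟨b', c, β⟩ := y
  obtain rfl : b' = b := h.1
  exact follows_iff.2 (follows_iff.1 h).1

/-- The sign of the lift is forced by `I^g`: it changes at a special middle vertex and is kept at an
ordinary one. In both cases the lifted arrow starts where `x` ends. -/
theorem exists_follows_of_gProj {x : Arrows (Qg Sp)} {β : Arrows Q}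
    (h : Follows I (gProj x) β) : ∃ y, Follows (GRelations I Sp) x y ∧ gProj y = β := by
  obtain ⟨a, b, α, δ, ha, hb⟩ := x
  obtain ⟨j, c, β⟩ := β
  obtain rfl : j = b.base := h.1
  have h' : I α β := follows_iff.1 h
  by_cases hj : b.base ∈ Sp
  · obtain ⟨c, rfl, hc⟩ : ∃ c' : Qg Sp, c'.base = c ∧ Qg.withSign Sp c (!δ) = c' :=
      ⟨_, Qg.base_withSign c _, rfl⟩
    refine ⟨⟨b, c, ⟨β, !δ, (Qg.withSign_eq_of_mem hj _ _).trans hb, hc⟩⟩, ?_, rfl⟩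
    exact follows_iff.2 ⟨h', Or.inr ⟨hj, by simp⟩⟩
  · obtain ⟨c, rfl, hc⟩ : ∃ c' : Qg Sp, c'.base = c ∧ Qg.withSign Sp c δ = c' :=
      ⟨_, Qg.base_withSign c _, rfl⟩
    exact ⟨⟨b, c, ⟨β, δ, hb, hc⟩⟩, follows_iff.2 ⟨h', Or.inl ⟨hj, rfl⟩⟩, rfl⟩

/-- Sequences of relations project to `Q`, and those of `Q` lift step by step from any lift of the
first arrow. -/
theorem relationsTerminate_gRelations_iff :
    RelationsTerminate (GRelations I Sp) ↔ RelationsTerminate I := by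
  constructor
  · intro h α
    obtain ⟨x, rfl⟩ := gProj_surjective (Sp := Sp) α
    induction h x with
    | intro x _ ih =>
      refine Acc.intro _ fun β hβ => ?_
      obtain ⟨y, hy, rfl⟩ := exists_follows_of_gProj hβ
      exact ih y hy
  · intro h x
    refine Subrelation.accessible (fun {x y} h => ?_) (InvImage.accessible gProj (h (gProj x)))
    exact Follows.gProj h

/-- Over an ordinary vertex the two lifts are distinct, so composable arrows have equal signs there
and a pair over `I` is in `I^g`. A pair over `I` outside `I^g` therefore meets at a special vertex.
-/
theorem chain_gProj {x y : Arrows (Qg Sp)}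
    (h : x.2.1 = y.1 ∧ ¬ Follows (GRelations I Sp) x y) :
    (gProj x).2.1 = (gProj y).1 ∧ (Follows I (gProj x) (gProj y) → (gProj x).2.1 ∈ Sp) := by
  obtain ⟨a, b, α⟩ := x
  obtain ⟨b', c, β⟩ := y
  obtain ⟨h1, h2⟩ := h
  obtain rfl : b = b' := h1
  refine ⟨rfl, fun h => ?_⟩
  by_contra hb
  refine h2 (follows_iff.2 ⟨follows_iff.1 h, Or.inl ⟨hb, ?_⟩⟩)
  exact Qg.withSign_injective hb ((GArrow.source_eq β).trans (GArrow.target_eq α).symm)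

theorem finite_arrows_Qg [Finite Q] [Finite (Arrows Q)] : Finite (Arrows (Qg Sp)) := by
  have : ∀ a b : Qg Sp, Finite (a ⟶ b) := fun a b => by
    have := finite_hom a.base b.base
    refine Finite.of_injective (fun e : GArrow Sp a b => (e.arrow, e.sign)) ?_
    rintro ⟨α, δ, _, _⟩ ⟨β, ε, _, _⟩ h
    obtain ⟨rfl, rfl⟩ := Prod.mk.inj h
    rfl
  infer_instance

end AssociatedGentlePair

end SkewedGentle

end

theorem corollary4p5 {K : Type*} [Field K] [IsAlgClosed K] {Q : Type*} [Quiver Q] [Finite Q]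
    (Sp : Set Q) (I : SkewedGentle.QuadraticRelations Q)
    (h : SkewedGentle.IsSkewedGentle K I Sp) :
    List.TFAE
      [SkewedGentle.globalDimension
          (SkewedGentle.BoundQuiverAlgebra K (SkewedGentle.sgRelations K I Sp)) < ⊤,
        SkewedGentle.globalDimension
          (SkewedGentle.BoundQuiverAlgebra K (SkewedGentle.zeroRelations K I)) < ⊤,
        SkewedGentle.globalDimension
          (SkewedGentle.BoundQuiverAlgebra K
            (SkewedGentle.zeroRelations K (SkewedGentle.GRelations I Sp))) < ⊤] := by
  have := SkewedGentle.finite_arrows h.gentle.card_out_le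
  have := SkewedGentle.finite_arrows_Qg (Sp := Sp)
  -- One bound serves all three algebras: their chains are, or project to, chains with relations
  -- only at special vertices.
  obtain ⟨m, hm⟩ := SkewedGentle.exists_length_lt_of_isChain h.gentle_sp
  rw [SkewedGentle.globalDimension_sgRelations_lt_top_iff K I ⟨m, hm⟩,
    SkewedGentle.globalDimension_zeroRelations_lt_top_iff K I ⟨m, fun l hl => hm l (hl.imp
      fun _ _ h => ⟨h.1, fun h' => absurd h' h.2⟩)⟩,
    SkewedGentle.globalDimension_zeroRelations_lt_top_iff K (SkewedGentle.GRelations I Sp)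
      ⟨m, fun l hl => by
        have := hm (l.map SkewedGentle.gProj)
          (List.isChain_map_of_isChain _ (fun _ _ h => SkewedGentle.chain_gProj h) hl)
        rwa [List.length_map] at this⟩,
    SkewedGentle.relationsTerminate_gRelations_iff]
  tfae_finish
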